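/- **Setting.** Let $x_{t+1}=f_*(x_t)$, $x_t\in\mathbb R^n$, with $f_*:\mathbb R^n\to\mathbb R^n$ (measurable), and let $x_t(\xi)$ be the state at time $t$ when $x_0=\xi$. Let $\xi$ be distributed according to a probability measure $\mathcal D$ on $\mathbb R^n$, let $T\ge 1$ and $B>0$, and assume $\|x_t(\xi)\|_2\le B$ for all $t=0,\dots,T$, for $\mathcal D$-almost every $\xi$. Let $\ell:\mathbb R^n\to[0,\infty)$ be locally Lipschitz with $\ell(0)=0$, and let $L>0$ be a Lipschitz constant of $\ell$ on $\{z:\|z\|_2\le 2B\}$. Let $S_0=(\xi_1,\dots,\xi_N)\sim\mathcal D^N$, $N\ge1$, and let $S$ be the set of trajectories $(x_0(\xi_i),\dots,x_T(\xi_i))$. For $f:\mathbb R^n\to\mathbb R^n$ put $$\mathrm{er}_{\mathcal D}[f]=\mathbb E_{\xi\sim\mathcal D}\Big[\tfrac1T\sum_{t=0}^{T-1}\ell\big(f(x_t(\xi))-x_{t+1}(\xi)\big)\Big],\qquad \hat{\mathrm{er}}_S[f]=\tfrac1{NT}\sum_{i=1}^N\sum_{t=0}^{T-1}\ell\big(f(x_t(\xi_i))-x_{t+1}(\xi_i)\big),$$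 and let $\bar f$ be the clipped version of $f$: $\bar f(x)=\frac{B}{\|f(x)\|_2}f(x)$ if $\|f(x)\|_2>B$, and $\bar f(x)=f(x)$ otherwise. **Classes.** For $k=1,\dots,K$ ($K\ge 1$) let $\kappa_k$ be a continuous positive definite symmetric kernel on $\mathbb R^n$ with reproducing kernel Hilbert space $\mathbb H_k$, let $b_k>0$, and let $\mathcal F_k$ be the set of $f=(f_1,\dots,f_n)$ with $f_j\in\mathbb H_k$ and $\|f_j\|_{\mathbb H_k}\le b_k$ for all $j$. Assume $\mathcal F_k\subseteq\mathcal F_{k+1}$ for all $k<K$, and put $\mathcal F=\bigcup_{k=1}^K\mathcal F_k$ and $k(f)=\min\{k:f\in\mathcal F_k\}$ for $f\in\mathcal F$. Let $0<M_1\le\dots\le M_Q=\max_k b_k$ ($Q\ge1$), and for $f\in\mathcal F_k$ let $$q_k(f)=\min\{q:\max_j\|f_j\|_{\mathbb H_k}\le M_q\}.$$ **Predictors.** For each sample and each $k$ let $f_k$ be a minimizer of $\hat{\mathrm{er}}_S[\bar f]$ over $f\in\mathcal F_k$ (any choice). Put $$r_k(S)=\frac{2\sqrt2\,L\,n\,M_{q_k(f_k)}}{TN}\sum_{t=0}^{T-1}\sqrt{\sum_{i=1}^N\kappa_k\big(x_t(\xi_i),x_t(\xi_i)\big)},$$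 let $\tilde r_k(S)=\tilde r_k(S;f)$, for $f\in\mathcal F_k$, be the same expression with $M_{q_k(f_k)}$ replaced by $M_{\max\{q_k(f_k),\,q_k(f)\}}$, and put $$\epsilon_k(S,\eta)=\epsilon_k(S,\eta;f)=\tilde r_k(S;f)+6LB\sqrt{\frac{\log(4Q/\eta)}{2N}}.$$ Let $f_S^{\mathrm{SRM}}$ be the class predictor $f_{\hat k}$ with the smallest value of $\hat{\mathrm{er}}_S[\bar f_k]+r_k(S)$; equivalently, $(\hat k,f_{\hat k})$ minimizes $\hat{\mathrm{er}}_S[\bar f]+r_k(S)$ over all $1\le k\le K$ and $f\in\mathcal F_k$. **Claim.** Let $\delta\in(0,1)$. 1. For each $k$, with probability at least $1-\delta$ over $S_0\sim\mathcal D^N$: for all $f\in\mathcal F_k$, $\ \big|\mathrm{er}_{\mathcal D}[\bar f]-\hat{\mathrm{er}}_S[\bar f]\big|\le\epsilon_k(S,\delta;f)$. 2. With probability at least $1-\delta$ over $S_0\sim\mathcal D^N$: for all $f\in\mathcal F$, $$\mathrm{er}_{\mathcal D}\big[\bar f_S^{\mathrm{SRM}}\big]\le \mathrm{er}_{\mathcal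 D}[\bar f]+2\,\epsilon_{k(f)}\Big(S,\frac{2\delta}{K+1};f\Big).$$ -/

import Mathlib

open MeasureTheory
open scoped NNReal

noncomputable section

/-- The state space `ℝⁿ` with the Euclidean norm. -/
abbrev State (n : ℕ) : Type := EuclideanSpace ℝ (Fin n)

/-! ### Kernels and their reproducing kernel Hilbert spaces -/

/-- A continuous positive definite symmetric kernel `κ : X × X → ℝ`. Positive semidefiniteness of
the (possibly infinite) matrix `κ` means that `κ` is symmetric and that
`∑ᵢ ∑ⱼ cᵢ cⱼ κ(xᵢ, xⱼ) ≥ 0` for all finite families of points and real coefficients. -/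
structure PDSKernel (X : Type) [TopologicalSpace X] where
  /-- the kernel function -/
  ker : X → X → ℝ
  continuous_ker : Continuous (Function.uncurry ker)
  posSemidef_ker : (Matrix.of ker).PosSemidef

namespace PDSKernel

variable {X : Type} [TopologicalSpace X] (κ : PDSKernel X)

/-- The kernel, each value being regarded as an operator on `ℝ`. -/
def opKernel : Matrix X X (ℝ →L[ℝ] ℝ) :=
  Matrix.of fun x y => κ.ker x y • ContinuousLinearMap.id ℝ ℝ

theorem posSemidef_opKernel : κ.opKernel.PosSemidef := by
  have hsymm : ∀ x y, κ.ker y x = κ.ker x y := fun x y => by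
    simpa using κ.posSemidef_ker.1.apply x y
  have hherm : κ.opKernel.IsHermitian := by
    ext x y
    simp [opKernel, Matrix.conjTranspose_apply, ContinuousLinearMap.star_eq_adjoint,
      ContinuousLinearMap.adjoint_id, hsymm x y]
  refine ((RKHS.posSemidef_tfae (K := κ.opKernel)).out 0 2).mpr (And.intro hherm fun vv => ?_)
  have h := κ.posSemidef_ker.2 vv
  simp only [Matrix.of_apply, star_trivial] at h
  refine h.trans_eq ?_
  simp only [opKernel, Matrix.of_apply, RCLike.re_to_real]
  refine Finsupp.sum_congr fun x _ => Finsupp.sum_congr fun y _ => ?_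
  rw [hsymm x y]
  simp
  ring

instance : Fact κ.opKernel.PosSemidef := ⟨κ.posSemidef_opKernel⟩

/-- The reproducing kernel Hilbert space of real functions on `X` associated to `κ`. -/
abbrev Space : Type := RKHS.OfKernel κ.opKernel

/-- The reproducing kernel of `κ.Space` is `κ`. -/
theorem kernel_space (x y : X) : RKHS.kernel κ.Space x y 1 = κ.ker x y := by
  have h : RKHS.kernel κ.Space = κ.opKernel := RKHS.OfKernel.kernel_ofKernel
  rw [h]
  simp [opKernel]

end PDSKernel

/-- The `b`-constrained RKHS with kernel `κ`: the maps `f : ℝⁿ → ℝⁿ` all of whose components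
`f_j` belong to the RKHS of `κ` with norm at most `b`. -/
def rkhsClass {n : ℕ} (κ : PDSKernel (State n)) (b : ℝ) : Set (State n → State n) :=
  {f | ∀ j : Fin n, ∃ h : κ.Space, (∀ x, h x = f x j) ∧ ‖h‖ ≤ b}

/-- `min {q ∈ {1, …, Q} | max_j ‖f_j‖ ≤ M_q}`, the norms being those of the RKHS of `κ`. -/
def normLevel {n : ℕ} (κ : PDSKernel (State n)) (Q : ℕ) (M : ℕ → ℝ)
    (f : State n → State n) : ℕ :=
  sInf {q | q ∈ Set.Icc 1 Q ∧ f ∈ rkhsClass κ (M q)}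

/-- `k(f) = min {k ∈ {1, …, K} | f ∈ F_k}`. -/
def classIndex {n : ℕ} (K : ℕ) (F : ℕ → Set (State n → State n)) (f : State n → State n) : ℕ :=
  sInf {k | k ∈ Set.Icc 1 K ∧ f ∈ F k}

/-! ### Trajectories, clipping and errors -/

/-- The state `x_t(ξ)` at time `t` of the system `x_{t+1} = fstar (x_t)` started at `x_0 = ξ`. -/
def traj {n : ℕ} (fstar : State n → State n) (t : ℕ) (ξ : State n) : State n := fstar^[t] ξ

/-- The clipped version of a predictor: values of norm larger than `B` are rescaled to norm `B`. -/
def clip {n : ℕ} (B : ℝ) (f : State n → State n) (x : State n) : State n :=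
  if B < ‖f x‖ then (B / ‖f x‖) • f x else f x

/-- `(1/T) ∑_{t<T} ℓ(f(x_t(ξ)) - x_{t+1}(ξ))`, the average loss along the trajectory from `ξ`. -/
def trajLoss {n : ℕ} (fstar : State n → State n) (T : ℕ) (ℓ : State n → ℝ)
    (f : State n → State n) (ξ : State n) : ℝ :=
  1 / (T : ℝ) * ∑ t ∈ Finset.range T, ℓ (f (traj fstar t ξ) - traj fstar (t + 1) ξ)

/-- The true error (risk) of the predictor `f`. -/
def trueError {n : ℕ} (fstar : State n → State n) (D : Measure (State n)) (T : ℕ)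
    (ℓ : State n → ℝ) (f : State n → State n) : ℝ :=
  ∫ ξ, trajLoss fstar T ℓ f ξ ∂D

/-- The training error of `f` on the trajectories with initial states `ξ 0, …, ξ (N - 1)`. -/
def trainError {n N : ℕ} (fstar : State n → State n) (T : ℕ) (ℓ : State n → ℝ)
    (ξ : Fin N → State n) (f : State n → State n) : ℝ :=
  1 / ((N : ℝ) * T) *
    ∑ i, ∑ t ∈ Finset.range T, ℓ (f (traj fstar t (ξ i)) - traj fstar (t + 1) (ξ i))

/-! ### Structural risk minimization -/

/-- The penalty with norm bound `m`:
`(2√2 L n m / (T N)) ∑_{t<T} √(∑ᵢ κ(x_t(ξᵢ), x_t(ξᵢ)))`. -/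
def rkhsPenalty {n N : ℕ} (fstar : State n → State n) (T : ℕ) (L : ℝ)
    (κ : PDSKernel (State n)) (ξ : Fin N → State n) (m : ℝ) : ℝ :=
  2 * √2 * L * n * m / ((T : ℝ) * N) *
    ∑ t ∈ Finset.range T, √(∑ i, κ.ker (traj fstar t (ξ i)) (traj fstar t (ξ i)))

/-- `f` minimizes over the class `F` the training error of the clipped predictors. -/
def IsClassPredictor {n N : ℕ} (fstar : State n → State n) (T : ℕ) (ℓ : State n → ℝ) (B : ℝ)
    (ξ : Fin N → State n) (F : Set (State n → State n)) (f : State n → State n) : Prop :=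
  f ∈ F ∧ ∀ g ∈ F, trainError fstar T ℓ ξ (clip B f) ≤ trainError fstar T ℓ ξ (clip B g)

/-- `f` is the SRM predictor for the classes `F 1, …, F K`, with penalties `r 1, …, r K`, and class
predictors `fhat 1, …, fhat K`: it is one of the class predictors, `f = fhat k`, and `(k, f)`
minimizes training error plus penalty over all pairs `(k', g)` with `g ∈ F k'`. -/
def IsSRMPredictor {n N : ℕ} (fstar : State n → State n) (T : ℕ) (ℓ : State n → ℝ) (B : ℝ)
    (ξ : Fin N → State n) (K : ℕ) (F : ℕ → Set (State n → State n)) (r : ℕ → ℝ)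
    (fhat : ℕ → State n → State n) (f : State n → State n) : Prop :=
  ∃ k ∈ Set.Icc 1 K, f = fhat k ∧ ∀ k' ∈ Set.Icc 1 K, ∀ g ∈ F k',
    trainError fstar T ℓ ξ (clip B f) + r k ≤ trainError fstar T ℓ ξ (clip B g) + r k'

/-- `P` holds with probability at least `p` under `μ` (on some event of probability at least
`p`, so that nothing has to be known about the measurability of `P`). -/
def HoldsWithProb {Ω : Type} [MeasurableSpace Ω] (μ : Measure Ω) (p : ℝ) (P : Ω → Prop) : Prop :=
  ∃ A : Set Ω, MeasurableSet A ∧ ENNReal.ofReal p ≤ μ A ∧ ∀ ω ∈ A, P ω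

end

/-! The randomness lies only in the `N` independent initial states. A whole trajectory is therefore
one sample point, its loss is a time average, and the dependence between successive states is
harmless. On trajectories that stay in the ball of radius `B`, the loss of a clipped predictor lies
in `[0, 2LB]`.

For a finite family of such losses, the largest deviation minus twice the empirical Rademacher
complexity has nonpositive mean by symmetrization (`integral_supDeviation_le`) and is concentrated
by McDiarmid's inequality (`measure_boundedDifferences_le`). The resulting bound involves only the
observed sample. It extends to the uncountable class through a pointwise dense sequence and its
finite initial segments, so no supremum over an uncountable class has to be measurable.

The complexity is bounded one time step at a time. Clipping is a metric projection, so the loss is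
an `L`-Lipschitz function of the vector `f(x)`, and vector contraction (`expect_iSup_contraction`)
replaces it by a linear function of the coordinates. The price is `√2`, the sharp Khintchine
constant, which follows from a Poincaré inequality with doubled gap for even functions on the cube.
The reproducing property and Cauchy–Schwarz then give `n m √(∑ κ)`. With the 2 from symmetrization
this is the penalty.

A union bound over two signs, `Q` norm levels and `K` classes makes everything simultaneous. On the
good event, the risk of the selected predictor is at most its training error plus its own penalty
plus the confidence term. By minimality this sum does not exceed its counterpart for any competitor,
whose training error is in turn close to its risk. The maximum of levels in `r̃` dominates both
penalties that appear. -/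

noncomputable section

open scoped BigOperators
open Filter Topology

/-! ### Signs, flips and Poincaré inequalities on the discrete cube. -/

/-- The real sign attached to a boolean. -/
def boolSign (b : Bool) : ℝ := if b then 1 else -1

theorem boolSign_not (b : Bool) : boolSign (!b) = -boolSign b := by
  cases b <;> simp [boolSign]

theorem boolSign_sq (b : Bool) : boolSign b ^ 2 = 1 := by
  cases b <;> simp [boolSign]

theorem abs_boolSign (b : Bool) : |boolSign b| = 1 := by
  cases b <;> simp [boolSign]

theorem expect_bool (f : Bool → ℝ) : 𝔼 b, f b = (f true + f false) / 2 := by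
  rw [Finset.expect_eq_sum_div_card]
  simp

theorem expect_fin_succ {α : Type*} [Fintype α] {n : ℕ} (f : (Fin (n + 1) → α) → ℝ) :
    𝔼 σ, f σ = 𝔼 a, 𝔼 σ : Fin n → α, f (Fin.cons a σ) := by
  classical
  rw [← Finset.expect_product']
  exact (Fintype.expect_equiv (Fin.consEquiv fun _ => α) (fun p => f (Fin.cons p.1 p.2)) f
    (fun _ => rfl)).symm

/-- The antipodal map of the discrete cube. -/
def antipode {ι : Type*} (σ : ι → Bool) : ι → Bool := fun i => !σ i

theorem antipode_antipode {ι : Type*} (σ : ι → Bool) : antipode (antipode σ) = σ := by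
  funext i; simp [antipode]

theorem antipode_cons {n : ℕ} (b : Bool) (σ : Fin n → Bool) :
    antipode (Fin.cons b σ : Fin (n + 1) → Bool) = Fin.cons (!b) (antipode σ) := by
  funext i
  refine Fin.cases ?_ (fun i => ?_) i <;> simp [antipode]

/-- Change the `i`-th sign. -/
def flipAt {n : ℕ} (i : Fin n) (σ : Fin n → Bool) : Fin n → Bool := Function.update σ i (!σ i)

theorem flipAt_flipAt {n : ℕ} (i : Fin n) (σ : Fin n → Bool) : flipAt i (flipAt i σ) = σ := by
  simp [flipAt]

theorem flipAt_antipode {n : ℕ} (i : Fin n) (σ : Fin n → Bool) :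
    flipAt i (antipode σ) = antipode (flipAt i σ) := by
  funext j
  by_cases h : j = i
  · subst h; simp [flipAt, antipode]
  · simp [flipAt, antipode, h]

theorem flipAt_zero_cons {n : ℕ} (b : Bool) (σ : Fin n → Bool) :
    flipAt 0 (Fin.cons b σ : Fin (n + 1) → Bool) = Fin.cons (!b) σ := by
  simp [flipAt]

theorem flipAt_succ_cons {n : ℕ} (i : Fin n) (b : Bool) (σ : Fin n → Bool) :
    flipAt i.succ (Fin.cons b σ : Fin (n + 1) → Bool) = Fin.cons b (flipAt i σ) := by
  simp [flipAt, Fin.cons_update]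

theorem expect_antipode {n : ℕ} (f : (Fin n → Bool) → ℝ) :
    𝔼 σ, f (antipode σ) = 𝔼 σ, f σ :=
  Fintype.expect_equiv (Function.Involutive.toPerm antipode antipode_antipode) _ _ fun _ => rfl

theorem expect_flipAt {n : ℕ} (i : Fin n) (f : (Fin n → Bool) → ℝ) :
    𝔼 σ, f (flipAt i σ) = 𝔼 σ, f σ :=
  Fintype.expect_equiv (Function.Involutive.toPerm (flipAt i) (flipAt_flipAt i)) _ _ fun _ => rfl

theorem sq_expect_le {α : Type*} [Fintype α] [Nonempty α] (f : α → ℝ) :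
    (𝔼 a, f a) ^ 2 ≤ 𝔼 a, f a ^ 2 := by
  have h : 0 ≤ 𝔼 a, (f a - 𝔼 b, f b) ^ 2 := Finset.expect_nonneg fun _ _ => sq_nonneg _
  have h2 : 𝔼 a, (f a - 𝔼 b, f b) ^ 2 = 𝔼 a, f a ^ 2 - (𝔼 a, f a) ^ 2 := by
    have : ∀ a, (f a - 𝔼 b, f b) ^ 2 = f a ^ 2 - 2 * (𝔼 b, f b) * f a + (𝔼 b, f b) ^ 2 := by
      intro a; ring
    simp only [this, Finset.expect_add_distrib, Finset.expect_sub_distrib, ← Finset.mul_expect,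
      Fintype.expect_const]
    ring
  linarith

/-- The Dirichlet form of the discrete cube. -/
def cubeEnergy {n : ℕ} (f : (Fin n → Bool) → ℝ) : ℝ :=
  ∑ i, 𝔼 σ, (f σ - f (flipAt i σ)) ^ 2

theorem cubeEnergy_succ {n : ℕ} (f : (Fin (n + 1) → Bool) → ℝ) :
    cubeEnergy f = 𝔼 σ : Fin n → Bool, (f (Fin.cons true σ) - f (Fin.cons false σ)) ^ 2 +
      (cubeEnergy (fun σ : Fin n → Bool => f (Fin.cons true σ)) +
        cubeEnergy (fun σ : Fin n → Bool => f (Fin.cons false σ))) / 2 := by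
  simp only [cubeEnergy, Fin.sum_univ_succ, expect_fin_succ, expect_bool, flipAt_zero_cons,
    flipAt_succ_cons]
  congr 1
  · have : ∀ σ : Fin n → Bool, (f (Fin.cons false σ) - f (Fin.cons true σ)) ^ 2 =
        (f (Fin.cons true σ) - f (Fin.cons false σ)) ^ 2 := fun σ => by ring
    simp [this]
  · rw [← Finset.sum_div, Finset.sum_add_distrib]

/-- The Poincaré inequality on the discrete cube. -/
theorem cube_poincare : ∀ {n : ℕ} (f : (Fin n → Bool) → ℝ),
    𝔼 σ, f σ ^ 2 - (𝔼 σ, f σ) ^ 2 ≤ cubeEnergy f / 4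
  | 0, f => by simp [cubeEnergy]
  | n + 1, f => by
    -- The variance is the mean of the two conditional variances plus a quarter of the squared
    -- difference of the conditional means. Jensen (`hd`) bounds the latter by the energy in the
    -- first coordinate.
    have h1 := cube_poincare fun σ : Fin n → Bool => f (Fin.cons true σ)
    have h0 := cube_poincare fun σ : Fin n → Bool => f (Fin.cons false σ)
    have hd := sq_expect_le fun σ : Fin n → Bool => f (Fin.cons true σ) - f (Fin.cons false σ)
    rw [Finset.expect_sub_distrib] at hd
    rw [cubeEnergy_succ]
    simp only [expect_fin_succ, expect_bool]
    linarith

/-- The Poincaré inequality with doubled spectral gap for even functions on the discrete cube. -/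
theorem cube_poincare_even : ∀ {n : ℕ} (f : (Fin n → Bool) → ℝ) (_ : ∀ σ, f (antipode σ) = f σ),
    2 * (𝔼 σ, f σ ^ 2 - (𝔼 σ, f σ) ^ 2) ≤ cubeEnergy f / 4
  | 0, f, _ => by simp [cubeEnergy]
  | n + 1, f, hf => by
    -- An even function is determined by its half `g`. With `g = e + o` split by parity, the first
    -- coordinate contributes `4 E o²` to the energy. This supplies the second copy of `E o²`, the
    -- first being the ordinary Poincaré inequality for the centred `o`; induction handles `e`.
    set g : (Fin n → Bool) → ℝ := fun σ => f (Fin.cons true σ) with hg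
    have hg' : ∀ σ : Fin n → Bool, f (Fin.cons false σ) = g (antipode σ) := fun σ => by
      rw [hg, ← hf]; simp [antipode_cons]
    set e : (Fin n → Bool) → ℝ := fun σ => (g σ + g (antipode σ)) / 2 with he
    set o : (Fin n → Bool) → ℝ := fun σ => (g σ - g (antipode σ)) / 2 with ho
    have hev : ∀ σ, e (antipode σ) = e σ := fun σ => by
      simp only [he, antipode_antipode]; ring
    have hod : ∀ σ, o (antipode σ) = -o σ := fun σ => by
      simp only [ho, antipode_antipode]; ring
    have hge : ∀ σ, g σ = e σ + o σ := fun σ => by simp only [he, ho]; ring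
    have cross : ∀ u v : (Fin n → Bool) → ℝ, (∀ σ, u (antipode σ) = u σ) →
        (∀ σ, v (antipode σ) = -v σ) → 𝔼 σ, u σ * v σ = 0 := fun u v hu hv => by
      have := expect_antipode fun σ => u σ * v σ
      simp only [hu, hv, mul_neg, Finset.expect_neg_distrib] at this
      linarith
    have ho0 : 𝔼 σ, o σ = 0 := by simpa using cross (fun _ => 1) o (fun _ => rfl) hod
    have hsq : 𝔼 σ, g σ ^ 2 = 𝔼 σ, e σ ^ 2 + 𝔼 σ, o σ ^ 2 := by
      have : ∀ σ, g σ ^ 2 = e σ ^ 2 + o σ ^ 2 + 2 * (e σ * o σ) := fun σ => by rw [hge]; ring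
      simp only [this, Finset.expect_add_distrib, ← Finset.mul_expect, cross e o hev hod]
      ring
    have hmean : 𝔼 σ, g σ = 𝔼 σ, e σ := by
      simp only [hge, Finset.expect_add_distrib, ho0, add_zero]
    have henergy : cubeEnergy g = cubeEnergy e + cubeEnergy o := by
      simp only [cubeEnergy]
      rw [← Finset.sum_add_distrib]
      refine Finset.sum_congr rfl fun i _ => ?_
      have : ∀ σ, (g σ - g (flipAt i σ)) ^ 2 = (e σ - e (flipAt i σ)) ^ 2 +
          (o σ - o (flipAt i σ)) ^ 2 + 2 * ((e σ - e (flipAt i σ)) * (o σ - o (flipAt i σ))) :=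
        fun σ => by rw [hge, hge]; ring
      simp only [this, Finset.expect_add_distrib, ← Finset.mul_expect]
      rw [cross (fun σ => e σ - e (flipAt i σ)) (fun σ => o σ - o (flipAt i σ))]
      · ring
      · intro σ; simp only [flipAt_antipode, hev]
      · intro σ; simp only [flipAt_antipode, hod]; ring
    have hanti : cubeEnergy (fun σ => g (antipode σ)) = cubeEnergy g := by
      simp only [cubeEnergy]
      refine Finset.sum_congr rfl fun i _ => ?_
      simp only [← flipAt_antipode]
      exact expect_antipode fun σ => (g σ - g (flipAt i σ)) ^ 2
    have h1 := cube_poincare_even e hev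
    have h2 := cube_poincare o
    have h3 : 𝔼 σ, (g σ - g (antipode σ)) ^ 2 = 4 * 𝔼 σ, o σ ^ 2 := by
      rw [Finset.mul_expect]
      exact Finset.expect_congr rfl fun σ _ => by simp only [ho]; ring
    rw [cubeEnergy_succ]
    simp only [expect_fin_succ, expect_bool, hg']
    simp only [← hg, expect_antipode g, expect_antipode fun σ => g σ ^ 2]
    change _ ≤ (_ + (cubeEnergy g + cubeEnergy _) / 2) / 4
    rw [h3, hanti, henergy, hsq, hmean]
    rw [ho0] at h2
    linarith

/-! ### Second moments of sign sums and Khintchine's inequality. -/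

/-- Second moments of random combinations with independent centered signs. -/
theorem expect_norm_sum_sq {α : Type*} [Fintype α] [Nonempty α] (s : α → ℝ)
    (hs : 𝔼 a, s a = 0) (hs2 : ∀ a, s a ^ 2 = 1)
    {E : Type*} [NormedAddCommGroup E] [InnerProductSpace ℝ E] :
    ∀ {N : ℕ} (w : E) (u : Fin N → E),
      𝔼 σ : Fin N → α, ‖w + ∑ i, s (σ i) • u i‖ ^ 2 = ‖w‖ ^ 2 + ∑ i, ‖u i‖ ^ 2
  | 0, w, u => by simp
  | N + 1, w, u => by
    -- The vector `w` accumulates the summands already peeled off, so the induction hypothesis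
    -- applies to the shifted sum.
    simp only [expect_fin_succ, Fin.sum_univ_succ, Fin.cons_zero, Fin.cons_succ, ← add_assoc]
    simp only [expect_norm_sum_sq s hs hs2 _ (fun i => u i.succ)]
    simp only [norm_add_sq_real,
      inner_smul_right, norm_smul, mul_pow, Real.norm_eq_abs, sq_abs, hs2, one_mul,
      Finset.expect_add_distrib, Fintype.expect_const, ← Finset.mul_expect,
      ← Finset.expect_mul, hs]
    ring

theorem expect_boolSign : 𝔼 b, boolSign b = 0 := by
  rw [expect_bool]; simp [boolSign]

theorem expect_boolSign_apply {n : ℕ} (j : Fin n) :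
    𝔼 τ : Fin n → Bool, boolSign (τ j) = 0 := by
  have := expect_antipode fun τ : Fin n → Bool => boolSign (τ j)
  simp only [antipode, boolSign_not, Finset.expect_neg_distrib] at this
  linarith

/-- The Khintchine inequality for the first moment, with the optimal constant `√2`. -/
theorem norm_le_sqrt_two_mul_expect_abs {n : ℕ} (v : EuclideanSpace ℝ (Fin n)) :
    ‖v‖ ≤ √2 * 𝔼 σ : Fin n → Bool, |∑ j, boolSign (σ j) * v j| := by
  set S : (Fin n → Bool) → ℝ := fun σ => ∑ j, boolSign (σ j) * v j with hS
  set f : (Fin n → Bool) → ℝ := fun σ => |S σ| with hf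
  have hSa : ∀ σ, S (antipode σ) = -S σ := fun σ => by
    simp [hS, antipode, boolSign_not]
  have h2 : 𝔼 σ, f σ ^ 2 = ‖v‖ ^ 2 := by
    have := expect_norm_sum_sq boolSign expect_boolSign boolSign_sq (0 : ℝ) fun j => v j
    simp only [zero_add, smul_eq_mul, Real.norm_eq_abs, sq_abs, abs_zero] at this
    rw [EuclideanSpace.norm_sq_eq]
    simp only [hf, sq_abs, Real.norm_eq_abs]
    rw [this]; simp
  -- Flipping one sign of the linear form changes one term, so the flips of `S` sum to `(n - 2) S`.
  -- The triangle inequality turns this into a pointwise bound for `|S|`, hence energy at most `4 E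
  -- f²`.
  have hlap : ∀ σ, ((n : ℝ) - 2) * f σ ≤ ∑ i, f (flipAt i σ) := fun σ => by
    have hflip : ∀ i, S (flipAt i σ) = S σ - 2 * (boolSign (σ i) * v i) := fun i => by
      have : S (flipAt i σ) - S σ = - 2 * (boolSign (σ i) * v i) := by
        rw [hS, ← Finset.sum_sub_distrib, Finset.sum_eq_single i]
        · simp [flipAt, boolSign_not]; ring
        · intro j _ hj; simp [flipAt, hj]
        · simp
      linarith
    have hsum : ∑ i, S (flipAt i σ) = ((n : ℝ) - 2) * S σ := by
      simp only [hflip, Finset.sum_sub_distrib, ← Finset.mul_sum]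
      simp [hS]; ring
    calc ((n : ℝ) - 2) * f σ ≤ |(n : ℝ) - 2| * |S σ| :=
          mul_le_mul_of_nonneg_right (le_abs_self _) (abs_nonneg _)
      _ = |∑ i, S (flipAt i σ)| := by rw [hsum, abs_mul]
      _ ≤ _ := Finset.abs_sum_le_sum_abs _ _
  have hen : cubeEnergy f / 4 ≤ 𝔼 σ, f σ ^ 2 := by
    have : cubeEnergy f = ∑ i, (2 * 𝔼 σ, f σ ^ 2 - 2 * 𝔼 σ, f σ * f (flipAt i σ)) := by
      refine Finset.sum_congr rfl fun i _ => ?_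
      have h := expect_flipAt i fun σ => f σ ^ 2
      have : ∀ σ, (f σ - f (flipAt i σ)) ^ 2 =
        f σ ^ 2 + f (flipAt i σ) ^ 2 - 2 * (f σ * f (flipAt i σ)) := fun σ => by ring
      simp only [this, Finset.expect_add_distrib, Finset.expect_sub_distrib, h,
        ← Finset.mul_expect]
      ring
    have h3 : ((n : ℝ) - 2) * 𝔼 σ, f σ ^ 2 ≤ ∑ i, 𝔼 σ, f σ * f (flipAt i σ) := by
      rw [← Finset.expect_sum_comm, Finset.mul_expect]
      refine Finset.expect_le_expect fun σ _ => ?_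
      rw [← Finset.mul_sum]
      have := mul_le_mul_of_nonneg_left (hlap σ) (abs_nonneg (S σ))
      simp only [hf] at this ⊢
      linarith
    rw [this, Finset.sum_sub_distrib, ← Finset.mul_sum, ← Finset.mul_sum]
    simp only [Finset.sum_const, Finset.card_univ, Fintype.card_fin, nsmul_eq_mul]
    linarith
  -- Together with `hen`, this gives `2 (E f² - (E f)²) ≤ E f²`, that is, `‖v‖² ≤ 2 (E f)²`.
  have hp := cube_poincare_even f fun σ => by simp [hf, hSa]
  have h0 : 0 ≤ 𝔼 σ, f σ := Finset.expect_nonneg fun _ _ => abs_nonneg _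
  refine abs_le_of_sq_le_sq' ?_ (by positivity) |>.2
  rw [mul_pow, Real.sq_sqrt (by norm_num)]
  linarith

/-! ### Vector contraction for Rademacher averages. -/

theorem le_finite_iSup {ι : Type*} [Finite ι] (f : ι → ℝ) (a : ι) : f a ≤ ⨆ a, f a :=
  le_ciSup (Set.finite_range f).bddAbove a

/-- One step of vector contraction: a single sign in front of a Lipschitz function of a vector may
be replaced by independent signs in front of the coordinates. -/
theorem expect_iSup_contraction_single {ι : Type*} [Finite ι] [Nonempty ι] {n : ℕ} {L : ℝ}
    (hL : 0 ≤ L) (A h : ι → ℝ) (v : ι → EuclideanSpace ℝ (Fin n))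
    (hLip : ∀ a b, |h a - h b| ≤ L * ‖v a - v b‖) :
    𝔼 s : Bool, ⨆ a, (A a + boolSign s * h a) ≤
      𝔼 τ : Fin n → Bool, ⨆ a, (A a + √2 * L * ∑ j, boolSign (τ j) * v a j) := by
  set X : (Fin n → Bool) → ι → ℝ := fun τ a => √2 * L * ∑ j, boolSign (τ j) * v a j with hX
  set U : (Fin n → Bool) → ℝ := fun τ => ⨆ a, (A a + X τ a) with hU
  have hXa : ∀ τ a, X (antipode τ) a = -X τ a := fun τ a => by
    simp [hX, antipode, boolSign_not]
  -- The two values of the sign allow two competitors `a`, `b`. Khintchine bounds `L ‖v a - v b‖` by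
  -- a mean of `|X τ a - X τ b|`. Whichever sign the difference has, one competitor is charged to
  -- `τ` and the other to its antipode.
  have key : ∀ a b, A a + h a + (A b - h b) ≤ 2 * 𝔼 τ, U τ := fun a b => by
    have h1 := norm_le_sqrt_two_mul_expect_abs (v a - v b)
    have h2 : L * ‖v a - v b‖ ≤ 𝔼 τ, |X τ a - X τ b| := by
      refine (mul_le_mul_of_nonneg_left h1 hL).trans_eq ?_
      rw [Finset.mul_expect, Finset.mul_expect]
      refine Finset.expect_congr rfl fun τ _ => ?_
      simp only [hX]
      rw [← mul_sub, ← Finset.sum_sub_distrib, abs_mul, abs_of_nonneg (by positivity : 0 ≤ √2 * L)]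
      simp only [PiLp.sub_apply, mul_sub]
      ring
    have h3 : 𝔼 τ, (A a + A b + |X τ a - X τ b|) ≤ 𝔼 τ, (U τ + U (antipode τ)) := by
      refine Finset.expect_le_expect fun τ _ => ?_
      have e1 := le_finite_iSup (fun a => A a + X τ a)
      have e2 := le_finite_iSup (fun a => A a + X (antipode τ) a)
      have e1a := e1 a
      have e1b := e1 b
      have e2a := e2 a
      have e2b := e2 b
      simp only [hXa] at e2a e2b
      simp only [hU, hXa]
      rcases abs_cases (X τ a - X τ b) with ⟨h, _⟩ | ⟨h, _⟩ <;> rw [h] <;> linarith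
    simp only [Finset.expect_add_distrib, Fintype.expect_const, expect_antipode U] at h3
    have := (le_abs_self _).trans (hLip a b)
    linarith
  rw [expect_bool]
  have : (⨆ a, (A a + boolSign true * h a)) ≤
      2 * 𝔼 τ, U τ - ⨆ a, (A a + boolSign false * h a) := by
    refine ciSup_le fun a => ?_
    rw [le_sub_comm]
    refine ciSup_le fun b => ?_
    have := key a b
    simp only [boolSign, if_true, Bool.false_eq_true, if_false]
    linarith
  linarith

/-- Vector contraction for Rademacher averages over a finite family. -/
theorem expect_iSup_contraction {ι : Type*} [Finite ι] [Nonempty ι] {n : ℕ} {L : ℝ}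
    (hL : 0 ≤ L) : ∀ {N : ℕ} (A : ι → ℝ) (h : Fin N → ι → ℝ)
    (v : Fin N → ι → EuclideanSpace ℝ (Fin n))
    (_ : ∀ i a b, |h i a - h i b| ≤ L * ‖v i a - v i b‖),
    𝔼 σ : Fin N → Bool, ⨆ a, (A a + ∑ i, boolSign (σ i) * h i a) ≤
      𝔼 τ : Fin N → Fin n → Bool,
        ⨆ a, (A a + ∑ i, √2 * L * ∑ j, boolSign (τ i j) * v i a j)
  | 0, A, h, v, _ => by simp
  | N + 1, A, h, v, hLip => by
    rw [expect_fin_succ, expect_fin_succ]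
    simp only [Fin.sum_univ_succ, Fin.cons_zero, Fin.cons_succ]
    calc 𝔼 s : Bool, 𝔼 σ : Fin N → Bool,
          ⨆ a, (A a + (boolSign s * h 0 a + ∑ i : Fin N, boolSign (σ i) * h i.succ a))
        ≤ 𝔼 s : Bool, 𝔼 τ : Fin N → Fin n → Bool, ⨆ a, (A a + boolSign s * h 0 a +
            ∑ i : Fin N, √2 * L * ∑ j, boolSign (τ i j) * v i.succ a j) := by
          refine Finset.expect_le_expect fun s _ => ?_
          simp only [← add_assoc]
          exact expect_iSup_contraction hL (fun a => A a + boolSign s * h 0 a)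
            (fun i => h i.succ) (fun i => v i.succ) fun i => hLip i.succ
      _ = 𝔼 τ : Fin N → Fin n → Bool, 𝔼 s : Bool, ⨆ a, (A a +
            ∑ i : Fin N, √2 * L * ∑ j, boolSign (τ i j) * v i.succ a j + boolSign s * h 0 a) := by
          rw [Finset.expect_comm]
          simp only [add_right_comm]
      _ ≤ 𝔼 τ : Fin N → Fin n → Bool, 𝔼 τ₀ : Fin n → Bool, ⨆ a, (A a +
            ∑ i : Fin N, √2 * L * ∑ j, boolSign (τ i j) * v i.succ a j +
              √2 * L * ∑ j, boolSign (τ₀ j) * v 0 a j) :=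
          Finset.expect_le_expect fun τ _ =>
            expect_iSup_contraction_single hL _ _ _ (hLip 0)
      _ = _ := by
          rw [Finset.expect_comm]
          simp only [add_comm, add_left_comm]

/-! ### Hoeffding's lemma and McDiarmid's inequality. -/

theorem integrable_of_abs_le {Ω : Type*} [MeasurableSpace Ω] {μ : Measure Ω} [IsFiniteMeasure μ]
    {f : Ω → ℝ} (hf : Measurable f) {R : ℝ} (h : ∀ x, |f x| ≤ R) : Integrable f μ :=
  Integrable.of_bound hf.aestronglyMeasurable R (ae_of_all _ h)

theorem abs_integral_le_of_abs_le {Ω : Type*} [MeasurableSpace Ω] {μ : Measure Ω}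
    [IsProbabilityMeasure μ] {f : Ω → ℝ} {R : ℝ} (h : ∀ x, |f x| ≤ R) : |∫ x, f x ∂μ| ≤ R := by
  have := norm_integral_le_of_norm_le_const (μ := μ) (f := f) (C := R) (ae_of_all _ h)
  simpa using this

theorem measurable_fin_cons {X : Type*} [MeasurableSpace X] {N : ℕ} :
    Measurable fun p : X × (Fin N → X) => (Fin.cons p.1 p.2 : Fin (N + 1) → X) := by
  refine measurable_pi_lambda _ fun i => ?_
  refine Fin.cases ?_ (fun i => ?_) i
  · simpa using measurable_fst
  · simp only [Fin.cons_succ]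
    fun_prop

theorem integral_pi_fin_succ {X : Type*} [MeasurableSpace X] (μ : Measure X)
    [IsProbabilityMeasure μ] {N : ℕ} {f : (Fin (N + 1) → X) → ℝ} (hf : Measurable f) {R : ℝ}
    (h : ∀ x, |f x| ≤ R) :
    ∫ ξ, f ξ ∂(Measure.pi fun _ : Fin (N + 1) => μ) =
      ∫ η, ∫ x, f (Fin.cons x η) ∂μ ∂(Measure.pi fun _ : Fin N => μ) := by
  rw [← ((measurePreserving_piFinSuccAbove (fun _ : Fin (N + 1) => μ) 0).symm).integral_comp']
  have hcons : ∀ p : X × (Fin N → X),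
      (MeasurableEquiv.piFinSuccAbove (fun _ : Fin (N + 1) => X) 0).symm p =
        (Fin.cons p.1 p.2 : Fin (N + 1) → X) := fun p => by
    simp [MeasurableEquiv.piFinSuccAbove_symm_apply, Fin.insertNthEquiv]
  simp only [hcons]
  exact integral_prod_symm _
    (integrable_of_abs_le (hf.comp measurable_fin_cons) fun p => h (Fin.cons p.1 p.2))

/-- Hoeffding's lemma for a bounded function of oscillation at most `c`. -/
theorem integral_exp_le_of_oscillation {X : Type*} [MeasurableSpace X] (μ : Measure X)
    [IsProbabilityMeasure μ] {f : X → ℝ} (hf : Measurable f) {R : ℝ} (hR : ∀ x, |f x| ≤ R) {c : ℝ}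
    (hc : ∀ x y, f x - f y ≤ c) (s : ℝ) :
    ∫ x, Real.exp (s * f x) ∂μ ≤ Real.exp (s * ∫ x, f x ∂μ + s ^ 2 * c ^ 2 / 8) := by
  have : Nonempty X := nonempty_of_isProbabilityMeasure μ
  have hbdd : BddBelow (Set.range f) :=
    ⟨-R, by rintro _ ⟨x, rfl⟩; exact (abs_le.mp (hR x)).1⟩
  have hIcc : ∀ x, f x ∈ Set.Icc (⨅ y, f y) ((⨅ y, f y) + c) := fun x =>
    ⟨ciInf_le hbdd x, by
      have : f x - c ≤ ⨅ y, f y := le_ciInf fun y => by linarith [hc x y]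
      linarith⟩
  have h := (ProbabilityTheory.hasSubgaussianMGF_of_mem_Icc hf.aemeasurable
    (ae_of_all μ hIcc)).mgf_le s
  simp only [ProbabilityTheory.mgf, add_sub_cancel_left, NNReal.coe_pow, NNReal.coe_div, coe_nnnorm,
    Real.norm_eq_abs, NNReal.coe_ofNat, div_pow, sq_abs] at h
  have e : ∀ x, Real.exp (s * f x) =
      Real.exp (s * ∫ x, f x ∂μ) * Real.exp (s * (f x - ∫ x, f x ∂μ)) := fun x => by
    rw [← Real.exp_add]; ring_nf
  simp only [e, integral_const_mul]
  rw [Real.exp_add]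
  refine mul_le_mul_of_nonneg_left (h.trans_eq ?_) (Real.exp_pos _).le
  congr 1
  ring

theorem update_cons_succ {X : Type*} {N : ℕ} (x : X) (η : Fin N → X) (i : Fin N) (y : X) :
    (Fin.cons x (Function.update η i y) : Fin (N + 1) → X) =
      Function.update (Fin.cons x η) i.succ y := Fin.cons_update ..

/-- The exponential moment form of McDiarmid's bounded differences inequality. -/
theorem integral_exp_le_of_boundedDifferences {X : Type*} [MeasurableSpace X] (μ : Measure X)
    [IsProbabilityMeasure μ] {c R : ℝ} (s : ℝ) :
    ∀ {N : ℕ} (φ : (Fin N → X) → ℝ), Measurable φ → (∀ ξ, |φ ξ| ≤ R) →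
      (∀ ξ i x, φ (Function.update ξ i x) - φ ξ ≤ c) →
      ∫ ξ, Real.exp (s * φ ξ) ∂(Measure.pi fun _ : Fin N => μ) ≤
        Real.exp (s * ∫ ξ, φ ξ ∂(Measure.pi fun _ : Fin N => μ) + N * (s ^ 2 * c ^ 2 / 8))
  | 0, φ, _, _, _ => by
    have : φ = fun _ => φ Fin.elim0 := funext fun ξ => congrArg φ (Subsingleton.elim _ _)
    rw [this]
    simp
  | N + 1, φ, hφ, hR, hc => by
    have hexp : ∀ ξ, |Real.exp (s * φ ξ)| ≤ Real.exp (|s| * R) := fun ξ => by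
      rw [Real.abs_exp, Real.exp_le_exp]
      calc s * φ ξ ≤ |s * φ ξ| := le_abs_self _
        _ = |s| * |φ ξ| := abs_mul _ _
        _ ≤ _ := mul_le_mul_of_nonneg_left (hR ξ) (abs_nonneg _)
    rw [integral_pi_fin_succ μ (hφ.const_mul s).exp hexp,
      integral_pi_fin_succ μ hφ hR]
    -- Integrating out the first coordinate preserves the bounded differences of the others, and
    -- each conditional exponential moment costs one Hoeffding factor.
    set ψ : (Fin N → X) → ℝ := fun η => ∫ x, φ (Fin.cons x η) ∂μ with hψ
    have hslice : ∀ η : Fin N → X, Measurable fun x => φ (Fin.cons x η) := fun η =>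
      hφ.comp (measurable_fin_cons.comp (measurable_id.prodMk measurable_const))
    have hψm : Measurable ψ := by
      have : StronglyMeasurable fun p : X × (Fin N → X) => φ (Fin.cons p.1 p.2) :=
        (hφ.comp measurable_fin_cons).stronglyMeasurable
      exact this.integral_prod_left'.measurable
    have hψR : ∀ η, |ψ η| ≤ R := fun η => abs_integral_le_of_abs_le fun x => hR _
    have hψc : ∀ η i y, ψ (Function.update η i y) - ψ η ≤ c := fun η i y => by
      have hint : ∀ η, Integrable (fun x => φ (Fin.cons x η)) μ := fun η =>
        integrable_of_abs_le (hslice η) fun x => hR _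
      simp only [hψ]
      rw [← integral_sub (hint _) (hint _)]
      calc _ ≤ ∫ _, c ∂μ := by
            refine integral_mono ((hint _).sub (hint _)) (integrable_const _) fun x => ?_
            simp only [update_cons_succ]
            exact hc _ _ _
        _ = c := by simp
    have hinner : ∀ η : Fin N → X, ∫ x, Real.exp (s * φ (Fin.cons x η)) ∂μ ≤
        Real.exp (s ^ 2 * c ^ 2 / 8) * Real.exp (s * ψ η) := fun η => by
      rw [← Real.exp_add, add_comm (s ^ 2 * c ^ 2 / 8)]
      refine integral_exp_le_of_oscillation μ (hslice η) (fun x => hR _) (fun x y => ?_) s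
      have := hc (Fin.cons y η) 0 x
      simpa using this
    have hψexp : ∀ η, |Real.exp (s * ψ η)| ≤ Real.exp (|s| * R) := fun η => by
      rw [Real.abs_exp, Real.exp_le_exp]
      calc s * ψ η ≤ |s * ψ η| := le_abs_self _
        _ = |s| * |ψ η| := abs_mul _ _
        _ ≤ _ := mul_le_mul_of_nonneg_left (hψR η) (abs_nonneg _)
    calc _ ≤ ∫ η, Real.exp (s ^ 2 * c ^ 2 / 8) * Real.exp (s * ψ η)
            ∂(Measure.pi fun _ : Fin N => μ) := by
          refine integral_mono_of_nonneg
            (ae_of_all _ fun η => integral_nonneg fun x => (Real.exp_pos _).le) ?_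
            (ae_of_all _ hinner)
          exact (integrable_of_abs_le (hψm.const_mul s).exp
            hψexp).const_mul _
      _ = Real.exp (s ^ 2 * c ^ 2 / 8) * ∫ η, Real.exp (s * ψ η)
            ∂(Measure.pi fun _ : Fin N => μ) := integral_const_mul _ _
      _ ≤ Real.exp (s ^ 2 * c ^ 2 / 8) * Real.exp (s * ∫ η, ψ η
            ∂(Measure.pi fun _ : Fin N => μ) + N * (s ^ 2 * c ^ 2 / 8)) :=
          mul_le_mul_of_nonneg_left
            (integral_exp_le_of_boundedDifferences μ s ψ hψm hψR hψc) (Real.exp_pos _).le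
      _ = _ := by
          rw [← Real.exp_add]
          congr 1
          push_cast
          ring

/-- **McDiarmid's inequality** for functions of independent identically distributed variables,
with confidence level `δ`. -/
theorem measure_boundedDifferences_le {X : Type*} [MeasurableSpace X] (μ : Measure X)
    [IsProbabilityMeasure μ] {c R : ℝ} (hc0 : 0 < c) {N : ℕ} (hN : 1 ≤ N) (φ : (Fin N → X) → ℝ)
    (hφ : Measurable φ) (hR : ∀ ξ, |φ ξ| ≤ R) (hc : ∀ ξ i x, φ (Function.update ξ i x) - φ ξ ≤ c)
    {δ : ℝ} (hδ0 : 0 < δ) (hδ1 : δ ≤ 1) :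
    (Measure.pi fun _ : Fin N => μ)
      {ξ | ∫ ξ, φ ξ ∂(Measure.pi fun _ : Fin N => μ) + c * √(N * Real.log (1 / δ) / 2) ≤ φ ξ} ≤
        ENNReal.ofReal δ := by
  set P := Measure.pi fun _ : Fin N => μ
  set ℓ := Real.log (1 / δ) with hℓ
  have hℓ0 : 0 ≤ ℓ := Real.log_nonneg (by rw [le_div_iff₀ hδ0]; linarith)
  have hN0 : (0 : ℝ) < N := by exact_mod_cast hN
  set r := √(N * ℓ / 2) with hr
  have hr2 : r ^ 2 = N * ℓ / 2 := Real.sq_sqrt (by positivity)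
  -- This minimizes the Chernoff exponent `-s c r + N s² c² / 8`, whose minimum is `-2 r² / N = log
  -- δ`.
  set s := 4 * r / (N * c) with hs
  have hs0 : 0 ≤ s := by positivity
  have hexp : ∀ ξ, |Real.exp (s * φ ξ)| ≤ Real.exp (s * R) := fun ξ => by
    rw [Real.abs_exp, Real.exp_le_exp]
    exact mul_le_mul_of_nonneg_left ((le_abs_self _).trans (hR ξ)) hs0
  have h1 := ProbabilityTheory.measure_ge_le_exp_mul_mgf (μ := P) (X := φ)
    (∫ ξ, φ ξ ∂P + c * r) hs0
    (integrable_of_abs_le (hφ.const_mul s).exp hexp)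
  have h2 := integral_exp_le_of_boundedDifferences μ (c := c) s φ hφ hR hc
  have h3 := h1.trans (mul_le_mul_of_nonneg_left h2 (Real.exp_pos _).le)
  rw [← Real.exp_add] at h3
  have h4 : -s * (∫ ξ, φ ξ ∂P + c * r) + (s * ∫ ξ, φ ξ ∂P + N * (s ^ 2 * c ^ 2 / 8)) =
      Real.log δ := by
    have e1 : s * (c * r) = 2 * ℓ := by
      rw [hs]; field_simp; rw [hr2]; ring
    have e2 : N * (s ^ 2 * c ^ 2 / 8) = ℓ := by
      rw [hs]; field_simp; rw [hr2]; ring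
    have e3 : ℓ = -Real.log δ := by rw [hℓ, one_div, Real.log_inv]
    rw [e2]
    linarith
  rw [h4, Real.exp_log hδ0] at h3
  rw [← ofReal_measureReal]
  exact ENNReal.ofReal_le_ofReal h3

/-! ### Symmetrization and data-dependent deviation bounds. -/

/-- The supremum over the family `g` of the sums `∑ᵢ σᵢ g(ξᵢ)`. -/
def signedSup {X ι : Type*} {N : ℕ} (g : ι → X → ℝ) (σ : Fin N → Bool) (ξ : Fin N → X) : ℝ :=
  ⨆ a, ∑ i, boolSign (σ i) * g a (ξ i)

/-- The (unnormalized) empirical Rademacher complexity of the family `g`. -/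
def empRademacher {X ι : Type*} {N : ℕ} (g : ι → X → ℝ) (ξ : Fin N → X) : ℝ :=
  𝔼 σ : Fin N → Bool, signedSup g σ ξ

/-- The largest (unnormalized) deviation of expectations from sample averages. -/
def supDeviation {X ι : Type*} [MeasurableSpace X] {N : ℕ} (μ : Measure X) (g : ι → X → ℝ)
    (ξ : Fin N → X) : ℝ :=
  ⨆ a, ∑ i, (∫ x, g a x ∂μ - g a (ξ i))

theorem abs_iSup_le {ι : Type*} [Nonempty ι] [Finite ι] {f : ι → ℝ} {K : ℝ}
    (h : ∀ a, |f a| ≤ K) : |⨆ a, f a| ≤ K := by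
  obtain ⟨a⟩ := ‹Nonempty ι›
  have : Nonempty ι := ⟨a⟩
  exact abs_le.mpr ⟨(abs_le.mp (h a)).1.trans (le_finite_iSup f a),
    ciSup_le fun a => (abs_le.mp (h a)).2⟩

theorem abs_fin_sum_le {N : ℕ} {f : Fin N → ℝ} {K : ℝ} (h : ∀ i, |f i| ≤ K) :
    |∑ i, f i| ≤ N * K := by
  refine (Finset.abs_sum_le_sum_abs _ _).trans ?_
  refine (Finset.sum_le_sum fun i _ => h i).trans_eq ?_
  simp

theorem sum_update_sub {X : Type*} {N : ℕ} (F : Fin N → X → ℝ) (ξ : Fin N → X) (i : Fin N)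
    (x : X) :
    ∑ j, F j (Function.update ξ i x j) = ∑ j, F j (ξ j) + (F i x - F i (ξ i)) := by
  have : ∑ j, F j (Function.update ξ i x j) - ∑ j, F j (ξ j) = F i x - F i (ξ i) := by
    rw [← Finset.sum_sub_distrib, Finset.sum_eq_single i]
    · simp
    · intro j _ hj; simp [hj]
    · simp
  linarith

section
variable {X ι : Type*} {N : ℕ} {g : ι → X → ℝ} {K C : ℝ}

theorem abs_boolSign_mul_le (b : Bool) {y : ℝ} (h : |y| ≤ K) : |boolSign b * y| ≤ K := by
  rwa [abs_mul, abs_boolSign, one_mul]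

theorem boolSign_mul_le (b : Bool) {y : ℝ} (h : y ≤ C) (h' : -y ≤ C) : boolSign b * y ≤ C := by
  cases b
  · simpa [boolSign] using h'
  · simpa [boolSign] using h

theorem abs_signedSup_le [Nonempty ι] [Finite ι] (hK : ∀ a x, |g a x| ≤ K) (σ : Fin N → Bool)
    (ξ : Fin N → X) : |signedSup g σ ξ| ≤ N * K :=
  abs_iSup_le fun _ => abs_fin_sum_le fun _ => abs_boolSign_mul_le _ (hK _ _)

theorem abs_empRademacher_le [Nonempty ι] [Finite ι] (hK : ∀ a x, |g a x| ≤ K) (ξ : Fin N → X) :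
    |empRademacher g ξ| ≤ N * K := by
  refine (Finset.abs_expect_le _ _).trans ?_
  refine (Finset.expect_le_expect fun σ _ => abs_signedSup_le hK σ ξ).trans_eq ?_
  simp

theorem empRademacher_update_le [Nonempty ι] [Finite ι] (hC : ∀ a x y, g a x - g a y ≤ C)
    (ξ : Fin N → X) (i : Fin N) (x : X) :
    empRademacher g ξ - empRademacher g (Function.update ξ i x) ≤ C := by
  have : empRademacher g ξ ≤ 𝔼 σ : Fin N → Bool,
      (signedSup g σ (Function.update ξ i x) + C) := by
    refine Finset.expect_le_expect fun σ _ => ciSup_le fun a => ?_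
    have h1 := le_finite_iSup
      (fun a => ∑ j, boolSign (σ j) * g a (Function.update ξ i x j)) a
    simp only [sum_update_sub (fun j x => boolSign (σ j) * g a x)] at h1
    have h2 : boolSign (σ i) * (g a (ξ i) - g a x) ≤ C :=
      boolSign_mul_le _ (hC _ _ _) (by linarith [hC a x (ξ i)])
    simp only [signedSup]
    linarith
  rw [Finset.expect_add_distrib, Fintype.expect_const] at this
  simp only [empRademacher] at this ⊢
  linarith

variable [MeasurableSpace X] (μ : Measure X)

theorem supDeviation_update_le [Nonempty ι] [Finite ι] (hC : ∀ a x y, g a x - g a y ≤ C)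
    (ξ : Fin N → X) (i : Fin N) (x : X) :
    supDeviation μ g (Function.update ξ i x) - supDeviation μ g ξ ≤ C := by
  have : supDeviation μ g (Function.update ξ i x) ≤ supDeviation μ g ξ + C := by
    refine ciSup_le fun a => ?_
    rw [sum_update_sub (fun _ y => ∫ x, g a x ∂μ - g a y)]
    have h1 := le_finite_iSup (fun a => ∑ i, (∫ x, g a x ∂μ - g a (ξ i))) a
    have := hC a (ξ i) x
    simp only [supDeviation]
    linarith
  linarith

theorem abs_supDeviation_le [IsProbabilityMeasure μ] [Nonempty ι] [Finite ι]
    (hK : ∀ a x, |g a x| ≤ K) (ξ : Fin N → X) : |supDeviation μ g ξ| ≤ N * (2 * K) := by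
  refine abs_iSup_le fun a => abs_fin_sum_le fun i => ?_
  have h1 := abs_integral_le_of_abs_le (μ := μ) (hK a)
  have h2 := hK a (ξ i)
  exact (abs_sub _ _).trans (by linarith)

theorem measurable_signedSup [Finite ι] (hg : ∀ a, Measurable (g a)) (σ : Fin N → Bool) :
    Measurable (signedSup g σ) := by
  refine Measurable.iSup fun a => Finset.measurable_sum _ fun i _ => ?_
  exact ((hg a).comp (measurable_pi_apply i)).const_mul _

theorem measurable_empRademacher [Finite ι] (hg : ∀ a, Measurable (g a)) :
    Measurable (empRademacher g : (Fin N → X) → ℝ) := by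
  have : (empRademacher g : (Fin N → X) → ℝ) = fun ξ =>
      (∑ σ : Fin N → Bool, signedSup g σ ξ) / (Fintype.card (Fin N → Bool) : ℝ) :=
    funext fun ξ => Fintype.expect_eq_sum_div_card _
  rw [this]
  exact (Finset.measurable_sum _ fun σ _ => measurable_signedSup hg σ).div_const _

theorem measurable_supDeviation [Finite ι] (hg : ∀ a, Measurable (g a)) :
    Measurable (supDeviation μ g : (Fin N → X) → ℝ) := by
  refine Measurable.iSup fun a => Finset.measurable_sum _ fun i _ => ?_
  exact ((hg a).comp (measurable_pi_apply i)).const_sub _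

theorem integral_expect_eq {Ω α : Type*} [MeasurableSpace Ω] [Fintype α] (P : Measure Ω)
    {f : α → Ω → ℝ} (hf : ∀ a, Integrable (f a) P) :
    ∫ ω, 𝔼 a, f a ω ∂P = 𝔼 a, ∫ ω, f a ω ∂P := by
  simp only [Fintype.expect_eq_sum_div_card]
  rw [integral_div, integral_finsetSum _ fun a _ => hf a]

variable [IsProbabilityMeasure μ]

/-- Exchanging the two members of some of the pairs of a product sample preserves its law. -/
theorem measurePreserving_swap_of_signs (σ : Fin N → Bool) :
    MeasurePreserving (fun (w : Fin N → X × X) i => if σ i then w i else (w i).swap)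
      (Measure.pi fun _ => μ.prod μ) (Measure.pi fun _ => μ.prod μ) := by
  refine measurePreserving_pi _ _ (f := fun i (p : X × X) => if σ i then p else p.swap) fun i => ?_
  cases σ i
  · simpa using! Measure.measurePreserving_swap (μ := μ) (ν := μ)
  · simpa using! MeasurePreserving.id (μ.prod μ)

/-- **Symmetrization**: the expected largest deviation is at most twice the expected empirical
Rademacher complexity. -/
theorem integral_supDeviation_le [Nonempty ι] [Finite ι] (hg : ∀ a, Measurable (g a))
    (hK : ∀ a x, |g a x| ≤ K) :
    ∫ ξ, supDeviation μ g ξ ∂(Measure.pi fun _ : Fin N => μ) ≤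
      2 * ∫ ξ, empRademacher g ξ ∂(Measure.pi fun _ : Fin N => μ) := by
  set P := Measure.pi fun _ : Fin N => μ with hP
  set PP := Measure.pi fun _ : Fin N => μ.prod μ with hPP
  set H : (Fin N → X) × (Fin N → X) → ℝ := fun p => ⨆ a, ∑ i, (g a (p.2 i) - g a (p.1 i)) with hH
  have hHK : ∀ p, |H p| ≤ N * (2 * K) := fun p =>
    abs_iSup_le fun a => abs_fin_sum_le fun i =>
      (abs_sub _ _).trans (by linarith [hK a (p.1 i), hK a (p.2 i)])
  have hHm : Measurable H := by
    refine Measurable.iSup fun a => Finset.measurable_sum _ fun i _ => ?_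
    have := hg a
    fun_prop
  have hHi : Integrable H (P.prod P) := integrable_of_abs_le hHm hHK
  -- Ghost sample: each mean is the expectation over an independent copy, and the supremum of
  -- expectations is at most the expectation of the supremum.
  have h1 : ∫ ξ, supDeviation μ g ξ ∂P ≤ ∫ p, H p ∂(P.prod P) := by
    rw [integral_prod _ hHi]
    refine integral_mono (integrable_of_abs_le (measurable_supDeviation μ hg)
      (abs_supDeviation_le μ hK)) hHi.integral_prod_left fun ξ => ciSup_le fun a => ?_
    have hm : ∀ i : Fin N, Integrable (fun ξ' : Fin N → X => g a (ξ' i)) P := fun i =>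
      integrable_of_abs_le ((hg a).comp (measurable_pi_apply i)) fun ξ' => hK a _
    have hev : ∀ i : Fin N, ∫ ξ', g a (ξ' i) ∂P = ∫ x, g a x ∂μ := fun i => by
      have := (measurePreserving_eval (fun _ : Fin N => μ) i)
      rw [← this.map_eq, integral_map this.measurable.aemeasurable
        (by rw [this.map_eq]; exact (hg a).aestronglyMeasurable)]
    calc ∑ i, (∫ x, g a x ∂μ - g a (ξ i))
        = ∫ ξ', ∑ i, (g a (ξ' i) - g a (ξ i)) ∂P := by
          rw [integral_finsetSum _ fun i _ => Integrable.sub' (hm i) (integrable_const (g a (ξ i)))]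
          refine Finset.sum_congr rfl fun i _ => ?_
          rw [integral_sub (hm i) (integrable_const _), hev]
          simp
      _ ≤ ∫ ξ', H (ξ, ξ') ∂P := by
          refine integral_mono (integrable_finsetSum _ fun i _ =>
            (hm i).sub (integrable_const _)) ?_ fun ξ' => ?_
          · exact integrable_of_abs_le (hHm.comp measurable_prodMk_left) fun _ => hHK _
          · exact le_finite_iSup (fun a => ∑ i, (g a (ξ' i) - g a (ξ i))) a
  set W : (Fin N → X × X) → ℝ := fun w => H (fun i => (w i).1, fun i => (w i).2) with hW
  have hWm : Measurable W := hHm.comp (by fun_prop)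
  have h2 : ∫ p, H p ∂(P.prod P) = ∫ w, W w ∂PP := by
    have := measurePreserving_arrowProdEquivProdArrow X X (Fin N) (fun _ => μ) (fun _ => μ)
    rw [← this.integral_comp']
    rfl
  have hS : ∀ σ : Fin N → Bool, Integrable (signedSup g σ) P := fun σ =>
    integrable_of_abs_le (measurable_signedSup hg σ) (abs_signedSup_le hK σ)
  have hfst : MeasurePreserving (fun (w : Fin N → X × X) i => (w i).1) PP P :=
    measurePreserving_pi _ _ fun _ => measurePreserving_fst
  have hsnd : MeasurePreserving (fun (w : Fin N → X × X) i => (w i).2) PP P :=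
    measurePreserving_pi _ _ fun _ => measurePreserving_snd
  have hcomp : ∀ (q : (Fin N → X × X) → Fin N → X), MeasurePreserving q PP P →
      ∀ σ : Fin N → Bool, Integrable (fun w => signedSup g σ (q w)) PP ∧
        ∫ w, signedSup g σ (q w) ∂PP = ∫ ξ, signedSup g σ ξ ∂P := fun q hq σ => by
    refine ⟨hq.integrable_comp_of_integrable (hS σ), ?_⟩
    rw [← hq.map_eq, integral_map hq.measurable.aemeasurable
      (measurable_signedSup hg σ).aestronglyMeasurable]
  -- Swapping the pairs selected by `σ` puts signs on the differences. The supremum then splits into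
  -- one signed supremum for each half of the double sample.
  have h3 : ∀ σ : Fin N → Bool, ∫ w, W w ∂PP ≤
      ∫ ξ, signedSup g σ ξ ∂P + ∫ ξ, signedSup g (antipode σ) ξ ∂P := fun σ => by
    have hT := measurePreserving_swap_of_signs μ σ
    have : ∫ w, W w ∂PP = ∫ w, W (fun i => if σ i then w i else (w i).swap) ∂PP := by
      conv_lhs => rw [hPP, ← hT.map_eq]
      rw [integral_map hT.measurable.aemeasurable hWm.aestronglyMeasurable]
    rw [this, ← (hcomp _ hsnd σ).2, ← (hcomp _ hfst (antipode σ)).2,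
      ← integral_add (hcomp _ hsnd σ).1 (hcomp _ hfst (antipode σ)).1]
    refine integral_mono (integrable_of_abs_le (hWm.comp hT.measurable) fun _ => hHK _)
      ((hcomp _ hsnd σ).1.add (hcomp _ hfst (antipode σ)).1) fun w => ciSup_le fun a => ?_
    have e : ∀ i, g a (if σ i then w i else (w i).swap).2 - g a (if σ i then w i else (w i).swap).1
        = boolSign (σ i) * g a (w i).2 + boolSign (antipode σ i) * g a (w i).1 := fun i => by
      simp only [antipode]
      cases σ i <;> simp [boolSign] <;> ring
    simp only [e, Finset.sum_add_distrib]
    exact add_le_add (le_finite_iSup (fun a => ∑ i, boolSign (σ i) * g a (w i).2) a)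
      (le_finite_iSup (fun a => ∑ i, boolSign (antipode σ i) * g a (w i).1) a)
  have h4 : ∫ w, W w ∂PP ≤ 𝔼 σ : Fin N → Bool,
      (∫ ξ, signedSup g σ ξ ∂P + ∫ ξ, signedSup g (antipode σ) ξ ∂P) := by
    refine le_trans (le_of_eq ?_) (Finset.expect_le_expect fun σ _ => h3 σ)
    simp
  rw [Finset.expect_add_distrib, expect_antipode fun σ => ∫ ξ, signedSup g σ ξ ∂P,
    ← integral_expect_eq P hS] at h4
  have h5 : ∫ ξ, empRademacher g ξ ∂P = ∫ ξ, 𝔼 σ : Fin N → Bool, signedSup g σ ξ ∂P := rfl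
  rw [h5]
  linarith

/-- Data-dependent uniform deviation bound for a finite family. -/
theorem measure_supDeviation_sub_empRademacher_le [Nonempty ι] [Finite ι] (hN : 1 ≤ N)
    (hg : ∀ a, Measurable (g a)) (hK : ∀ a x, |g a x| ≤ K) (hC0 : 0 < C)
    (hC : ∀ a x y, g a x - g a y ≤ C) {δ : ℝ} (hδ0 : 0 < δ) (hδ1 : δ ≤ 1) :
    (Measure.pi fun _ : Fin N => μ) {ξ | 3 * C * √(N * Real.log (1 / δ) / 2) ≤
      supDeviation μ g ξ - 2 * empRademacher g ξ} ≤ ENNReal.ofReal δ := by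
  -- McDiarmid is applied once to the combined functional, with increments at most `C + 2C`, so `δ`
  -- need not be divided between the deviation and the complexity.
  refine (measure_mono ?_).trans (measure_boundedDifferences_le μ (c := 3 * C)
    (R := N * (2 * K) + 2 * (N * K)) (by positivity) hN
    (fun ξ => supDeviation μ g ξ - 2 * empRademacher g ξ)
    ((measurable_supDeviation μ hg).sub ((measurable_empRademacher hg).const_mul 2))
    (fun ξ => ?_) (fun ξ i x => ?_) hδ0 hδ1)
  · intro ξ hξ
    have : ∫ ξ, (supDeviation μ g ξ - 2 * empRademacher g ξ) ∂(Measure.pi fun _ : Fin N => μ)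
        ≤ 0 := by
      rw [integral_sub (integrable_of_abs_le (measurable_supDeviation μ hg)
        (abs_supDeviation_le μ hK)) ((integrable_of_abs_le (measurable_empRademacher hg)
        (abs_empRademacher_le hK)).const_mul 2), integral_const_mul]
      linarith [integral_supDeviation_le (N := N) μ hg hK]
    simp only [Set.mem_ofPred_eq] at hξ ⊢
    linarith
  · have h1 := abs_le.mp (abs_supDeviation_le μ hK ξ)
    have h2 := abs_le.mp (abs_empRademacher_le hK ξ)
    exact abs_le.mpr ⟨by linarith, by linarith⟩
  · have h1 := supDeviation_update_le μ hC ξ i x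
    have h2 := empRademacher_update_le hC ξ i x
    linarith

end

/-- Data-dependent uniform deviation bound for a sequence of functions: outside an exceptional set,
all deviations are controlled by any common bound for the empirical Rademacher complexities of the
initial segments of the sequence. -/
theorem exists_uniform_deviation {X : Type*} [MeasurableSpace X] (μ : Measure X)
    [IsProbabilityMeasure μ] {N : ℕ} (hN : 1 ≤ N) {g : ℕ → X → ℝ} (hg : ∀ a, Measurable (g a))
    {K C : ℝ} (hK : ∀ a x, |g a x| ≤ K) (hC0 : 0 < C) (hC : ∀ a x y, g a x - g a y ≤ C)
    {δ : ℝ} (hδ0 : 0 < δ) (hδ1 : δ ≤ 1) :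
    ∃ A : Set (Fin N → X), (Measure.pi fun _ : Fin N => μ) A ≤ ENNReal.ofReal δ ∧
      ∀ ξ ∉ A, ∀ R, (∀ m : ℕ, empRademacher (fun a : Fin (m + 1) => g a) ξ ≤ R) →
        ∀ a, ∑ i, (∫ x, g a x ∂μ - g a (ξ i)) ≤
          2 * R + 3 * C * √(N * Real.log (1 / δ) / 2) := by
  set gm : (m : ℕ) → Fin (m + 1) → X → ℝ := fun m a => g a with hgm
  -- Subtracting the same supremum for every segment makes the bad events increase with `m`.
  -- Continuity from below then bounds their union by `δ` without a union bound.
  set Rad : (Fin N → X) → ℝ := fun ξ => ⨆ m, empRademacher (gm m) ξ with hRad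
  set A : ℕ → Set (Fin N → X) := fun m =>
    {ξ | 3 * C * √(N * Real.log (1 / δ) / 2) ≤ supDeviation μ (gm m) ξ - 2 * Rad ξ} with hA
  have hmono : Monotone A := by
    intro m m' hmm ξ hξ
    have : supDeviation μ (gm m) ξ ≤ supDeviation μ (gm m') ξ := ciSup_le fun a =>
      le_finite_iSup (fun a : Fin (m' + 1) => ∑ i, (∫ x, g a x ∂μ - g a (ξ i)))
        (Fin.castLE (by omega) a)
    simp only [hA, Set.mem_ofPred_eq] at hξ ⊢
    linarith
  refine ⟨⋃ m, A m, ?_, fun ξ hξ R hR a => ?_⟩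
  · rw [hmono.measure_iUnion]
    refine iSup_le fun m => (measure_mono fun ξ hξ => ?_).trans
      (measure_supDeviation_sub_empRademacher_le μ (g := gm m) hN (fun a => hg a) (fun a => hK a)
        hC0 (fun a => hC a) hδ0 hδ1)
    have : empRademacher (gm m) ξ ≤ Rad ξ := by
      refine le_ciSup (f := fun m => empRademacher (gm m) ξ) ⟨N * K, ?_⟩ m
      rintro _ ⟨m, rfl⟩
      exact (abs_le.mp (abs_empRademacher_le (g := gm m) (fun a => hK a) ξ)).2
    simp only [hA, Set.mem_ofPred_eq] at hξ ⊢
    linarith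
  · have h1 : Rad ξ ≤ R := ciSup_le hR
    have h2 : ξ ∉ A a := fun h => hξ (Set.mem_iUnion.mpr ⟨a, h⟩)
    simp only [hA, Set.mem_ofPred_eq, not_le] at h2
    have h3 := le_finite_iSup (fun b : Fin (a + 1) => ∑ i, (∫ x, g b x ∂μ - g b (ξ i)))
      (Fin.last a)
    simp only [Fin.val_last] at h3
    simp only [supDeviation, hgm] at h2
    linarith

/-! ### Clipping -/

theorem norm_clip_le {n : ℕ} {B : ℝ} (hB : 0 < B) (f : State n → State n) (x : State n) :
    ‖clip B f x‖ ≤ B := by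
  unfold clip
  split_ifs with h
  · have : 0 < ‖f x‖ := hB.trans h
    rw [norm_smul, Real.norm_of_nonneg (by positivity), div_mul_cancel₀ _ this.ne']
  · exact not_lt.mp h

/-- The obtuse-angle characterization of the metric projection onto the ball. -/
theorem inner_sub_clip_le {n : ℕ} {B : ℝ} (hB : 0 < B) (f : State n → State n) (x w : State n)
    (hw : ‖w‖ ≤ B) : inner ℝ (f x - clip B f x) (w - clip B f x) ≤ 0 := by
  unfold clip
  split_ifs with h
  · have h0 : 0 < ‖f x‖ := hB.trans h
    have e : f x - (B / ‖f x‖) • f x = (1 - B / ‖f x‖) • f x := by rw [sub_smul, one_smul]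
    rw [e, inner_smul_left, inner_sub_right, inner_smul_right, real_inner_self_eq_norm_sq]
    have h1 : inner ℝ (f x) w ≤ ‖f x‖ * B :=
      (real_inner_le_norm _ _).trans (mul_le_mul_of_nonneg_left hw h0.le)
    have h2 : B / ‖f x‖ * ‖f x‖ ^ 2 = ‖f x‖ * B := by field_simp
    have h3 : B / ‖f x‖ ≤ 1 := (div_le_one h0).mpr h.le
    rw [h2]
    exact mul_nonpos_of_nonneg_of_nonpos (by simpa using h3) (by linarith)
  · simp

/-- Projection onto a convex set is nonexpansive: add the two obtuse-angle inequalities and apply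
Cauchy–Schwarz. Allowing two functions and two points covers contraction, continuity and limits at
once. -/
theorem norm_clip_sub_clip_le {n : ℕ} {B : ℝ} (hB : 0 < B) (f g : State n → State n)
    (x y : State n) : ‖clip B f x - clip B g y‖ ≤ ‖f x - g y‖ := by
  have h1 := inner_sub_clip_le hB f x _ (norm_clip_le hB g y)
  have h2 := inner_sub_clip_le hB g y _ (norm_clip_le hB f x)
  set p := clip B f x
  set q := clip B g y
  have h3 : ‖p - q‖ ^ 2 ≤ inner ℝ (f x - g y) (p - q) := by
    rw [← real_inner_self_eq_norm_sq]
    have : inner ℝ (f x - g y) (p - q) = inner ℝ (p - q) (p - q) -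
        inner ℝ (f x - p) (q - p) - inner ℝ (g y - q) (p - q) := by
      simp only [inner_sub_left, inner_sub_right]
      ring
    linarith
  have h4 := h3.trans (real_inner_le_norm _ _)
  rcases (norm_nonneg (p - q)).eq_or_lt with h | h
  · rw [← h]; exact norm_nonneg _
  · rw [sq] at h4
    exact le_of_mul_le_mul_right h4 h

theorem tendsto_clip {n : ℕ} {B : ℝ} (hB : 0 < B) {α : Type*} {l : Filter α}
    {F : α → State n → State n} {f : State n → State n} {z : α → State n} {x : State n}
    (h : Tendsto (fun a => F a (z a)) l (𝓝 (f x))) :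
    Tendsto (fun a => clip B (F a) (z a)) l (𝓝 (clip B f x)) := by
  rw [tendsto_iff_norm_sub_tendsto_zero] at h ⊢
  exact squeeze_zero (fun _ => norm_nonneg _) (fun a => norm_clip_sub_clip_le hB _ _ _ _) h

theorem continuous_clip {n : ℕ} {B : ℝ} (hB : 0 < B) {f : State n → State n}
    (hf : Continuous f) : Continuous (clip B f) :=
  continuous_iff_continuousAt.mpr fun _ => tendsto_clip hB (F := fun _ => f) (hf.tendsto _)

/-! ### Reproducing kernel Hilbert spaces -/

namespace PDSKernel

variable {X : Type} [TopologicalSpace X] (κ : PDSKernel X)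

/-- The canonical feature map of the kernel. -/
def feature (x : X) : κ.Space := RKHS.kerFun κ.Space x 1

theorem inner_feature (x : X) (h : κ.Space) : inner ℝ (κ.feature x) h = h x := by
  rw [feature, RKHS.kerFun_inner]
  simp

theorem inner_feature_feature (x y : X) : inner ℝ (κ.feature x) (κ.feature y) = κ.ker x y := by
  rw [inner_feature, feature, RKHS.kerFun_apply, kernel_space]

theorem norm_feature_sq (x : X) : ‖κ.feature x‖ ^ 2 = κ.ker x x := by
  rw [← real_inner_self_eq_norm_sq, inner_feature_feature]

/-- The squared distance of two features is `κ(x,x) - 2κ(x,y) + κ(y,y)`, which tends to 0 as `x`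
tends to `y`. -/
theorem continuous_feature : Continuous κ.feature := by
  refine continuous_iff_continuousAt.mpr fun y => ?_
  rw [ContinuousAt, tendsto_iff_norm_sub_tendsto_zero]
  have hc : Continuous fun x => √(κ.ker x x - 2 * κ.ker x y + κ.ker y y) := by
    have h1 : Continuous fun x => κ.ker x x :=
      κ.continuous_ker.comp (continuous_id.prodMk continuous_id)
    have h2 : Continuous fun x => κ.ker x y :=
      κ.continuous_ker.comp (continuous_id.prodMk continuous_const)
    fun_prop
  have h0 : √(κ.ker y y - 2 * κ.ker y y + κ.ker y y) = 0 := by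
    rw [show κ.ker y y - 2 * κ.ker y y + κ.ker y y = 0 by ring, Real.sqrt_zero]
  have h := hc.tendsto y
  rw [h0] at h
  refine h.congr fun x => ?_
  rw [← norm_feature_sq, ← norm_feature_sq, ← inner_feature_feature, ← norm_sub_sq_real,
    Real.sqrt_sq (norm_nonneg _)]

theorem continuous_coe (h : κ.Space) : Continuous fun x => h x := by
  simp only [← κ.inner_feature]
  exact κ.continuous_feature.inner continuous_const

end PDSKernel

theorem continuous_of_mem_rkhsClass {n : ℕ} {κ : PDSKernel (State n)} {b : ℝ}
    {f : State n → State n} (hf : f ∈ rkhsClass κ b) : Continuous f := by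
  have : Continuous fun x => (f x).ofLp := continuous_pi fun j => by
    obtain ⟨h, hh, -⟩ := hf j
    simp only [← hh]
    exact κ.continuous_coe h
  exact (PiLp.continuous_toLp 2 _).comp this

theorem rkhsClass_mono {n : ℕ} (κ : PDSKernel (State n)) {b b' : ℝ} (h : b ≤ b') :
    rkhsClass κ b ⊆ rkhsClass κ b' := fun _ hf j =>
  let ⟨g, hg, hb⟩ := hf j
  ⟨g, hg, hb.trans h⟩

/-- The constrained RKHS contains a sequence that is sequentially dense for pointwise
convergence. -/
theorem exists_pointwise_dense_seq {n : ℕ} (κ : PDSKernel (State n)) {b : ℝ} (hb : 0 ≤ b) :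
    ∃ u : ℕ → State n → State n, (∀ k, u k ∈ rkhsClass κ b) ∧
      ∀ f ∈ rkhsClass κ b, ∃ φ : ℕ → ℕ,
        ∀ x, Tendsto (fun k => u (φ k) x) atTop (𝓝 (f x)) := by
  let S := {f : C(State n, State n) // (f : State n → State n) ∈ rkhsClass κ b}
  have : Nonempty S := ⟨⟨0, fun j => ⟨0, fun x => by simp, by simpa using hb⟩⟩⟩
  -- Separability comes from the compact-open topology on continuous maps and passes to subspaces;
  -- evaluation at a point is continuous in it.
  have : SecondCountableTopology C(State n, State n) := inferInstance
  have : SecondCountableTopology S := TopologicalSpace.Subtype.secondCountableTopology _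
  obtain ⟨u, hu⟩ := TopologicalSpace.exists_dense_seq S
  refine ⟨fun k => (u k).1, fun k => (u k).2, fun f hf => ?_⟩
  let f' : S := ⟨⟨f, continuous_of_mem_rkhsClass hf⟩, hf⟩
  obtain ⟨w, hw, hlim⟩ := mem_closure_iff_seq_limit.mp (hu f')
  choose φ hφ using hw
  refine ⟨φ, fun x => ?_⟩
  have hev : Continuous fun s : S => s.1 x :=
    (continuous_eval_const x).comp continuous_subtype_val
  have := (hev.tendsto f').comp hlim
  simp only [Function.comp_def, ← hφ] at this
  exact this

/-- Jensen reduces to the second moment, where independence of the signs in column `j` removes the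
cross terms. -/
theorem expect_norm_sum_feature_le {n N : ℕ} (κ : PDSKernel (State n)) (x : Fin N → State n)
    (j : Fin n) :
    𝔼 τ : Fin N → Fin n → Bool, ‖∑ i, boolSign (τ i j) • κ.feature (x i)‖ ≤
      √(∑ i, κ.ker (x i) (x i)) := by
  refine Real.le_sqrt_of_sq_le ((sq_expect_le _).trans_eq ?_)
  have := expect_norm_sum_sq (fun τ : Fin n → Bool => boolSign (τ j)) (expect_boolSign_apply j)
    (fun τ => boolSign_sq (τ j)) (0 : κ.Space) fun i => κ.feature (x i)
  simpa [κ.norm_feature_sq] using this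

/-- The vector-valued Rademacher complexity of a norm-constrained RKHS. -/
theorem expect_iSup_rkhsClass_le {n N : ℕ} (κ : PDSKernel (State n)) {b c : ℝ} (hb : 0 ≤ b)
    (hc : 0 ≤ c) {ι : Type*} [Nonempty ι] {f : ι → State n → State n}
    (hf : ∀ a, f a ∈ rkhsClass κ b) (x : Fin N → State n) :
    𝔼 τ : Fin N → Fin n → Bool, ⨆ a, (∑ i, c * ∑ j, boolSign (τ i j) * f a (x i) j) ≤
      c * n * b * √(∑ i, κ.ker (x i) (x i)) := by
  calc _ ≤ 𝔼 τ : Fin N → Fin n → Bool,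
          c * b * ∑ j, ‖∑ i, boolSign (τ i j) • κ.feature (x i)‖ := by
        refine Finset.expect_le_expect fun τ _ => ciSup_le fun a => ?_
        rw [← Finset.mul_sum, mul_assoc]
        refine mul_le_mul_of_nonneg_left ?_ hc
        rw [Finset.sum_comm, Finset.mul_sum]
        refine Finset.sum_le_sum fun j _ => ?_
        -- By the reproducing property the signed sum of values is one inner product with `h`, so
        -- Cauchy–Schwarz bounds it uniformly in `a`.
        obtain ⟨h, hh, hhb⟩ := hf a j
        have : ∑ i, boolSign (τ i j) * f a (x i) j =
            inner ℝ (∑ i, boolSign (τ i j) • κ.feature (x i)) h := by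
          rw [sum_inner]
          refine Finset.sum_congr rfl fun i _ => ?_
          rw [real_inner_smul_left, κ.inner_feature, hh]
        rw [this, mul_comm b]
        exact (real_inner_le_norm _ _).trans (mul_le_mul_of_nonneg_left hhb (norm_nonneg _))
    _ = c * b * ∑ j, 𝔼 τ : Fin N → Fin n → Bool, ‖∑ i, boolSign (τ i j) • κ.feature (x i)‖ := by
        rw [← Finset.mul_expect, Finset.expect_sum_comm]
    _ ≤ c * b * ∑ _j : Fin n, √(∑ i, κ.ker (x i) (x i)) :=
        mul_le_mul_of_nonneg_left
          (Finset.sum_le_sum fun j _ => expect_norm_sum_feature_le κ x j) (mul_nonneg hc hb)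
    _ = _ := by
        simp only [Finset.sum_const, Finset.card_univ, Fintype.card_fin, nsmul_eq_mul]
        ring

/-! ### Losses along bounded trajectories and their Rademacher complexity. -/

/-- The initial states whose trajectory stays in the ball of radius `B` up to time `T`. -/
def boundedStarts {n : ℕ} (fstar : State n → State n) (T : ℕ) (B : ℝ) : Set (State n) :=
  {ξ | ∀ t ≤ T, ‖traj fstar t ξ‖ ≤ B}

theorem measurable_traj {n : ℕ} {fstar : State n → State n} (h : Measurable fstar) (t : ℕ) :
    Measurable (traj fstar t) := h.iterate t

theorem measurableSet_boundedStarts {n : ℕ} {fstar : State n → State n} (h : Measurable fstar)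
    (T : ℕ) (B : ℝ) : MeasurableSet (boundedStarts fstar T B) := by
  have : boundedStarts fstar T B = ⋂ t, ⋂ (_ : t ≤ T), {ξ | ‖traj fstar t ξ‖ ≤ B} := by
    ext; simp [boundedStarts]
  rw [this]
  exact MeasurableSet.iInter fun t => MeasurableSet.iInter fun _ =>
    measurableSet_le (measurable_traj h t).norm measurable_const

/-- The signed loss along a trajectory of the clipped predictor, set to zero at initial states with
unbounded trajectories. -/
def signedLoss {n : ℕ} (fstar : State n → State n) (T : ℕ) (ℓ : State n → ℝ) (B : ℝ) (s : Bool)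
    (f : State n → State n) : State n → ℝ :=
  (boundedStarts fstar T B).indicator fun ξ => boolSign s * trajLoss fstar T ℓ (clip B f) ξ

section
variable {n T : ℕ} {fstar : State n → State n} {B : ℝ} {ℓ : State n → ℝ} {L : ℝ≥0}

theorem signedLoss_of_mem {ξ : State n} (hξ : ξ ∈ boundedStarts fstar T B) (s : Bool)
    (f : State n → State n) :
    signedLoss fstar T ℓ B s f ξ = boolSign s * trajLoss fstar T ℓ (clip B f) ξ :=
  Set.indicator_of_mem hξ _

theorem clip_sub_mem_closedBall (hB : 0 < B) (f : State n → State n) (x : State n) {y : State n}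
    (hy : ‖y‖ ≤ B) : clip B f x - y ∈ Metric.closedBall (0 : State n) (2 * B) := by
  rw [mem_closedBall_zero_iff]
  exact (norm_sub_le _ _).trans (by linarith [norm_clip_le hB f x])

/-- Clipping keeps both arguments in the ball where `ℓ` is `L`-Lipschitz. The bound is in terms of
the unclipped values, so contraction removes loss and clipping together. -/
theorem abs_sub_le_of_clip (hB : 0 < B) (hL : LipschitzOnWith L ℓ (Metric.closedBall 0 (2 * B)))
    (f g : State n → State n) (x x' : State n) {y : State n} (hy : ‖y‖ ≤ B) :
    |ℓ (clip B f x - y) - ℓ (clip B g x' - y)| ≤ L * ‖f x - g x'‖ := by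
  have h := hL.dist_le_mul _ (clip_sub_mem_closedBall hB f x hy) _
    (clip_sub_mem_closedBall hB g x' hy)
  rw [Real.dist_eq, dist_eq_norm, sub_sub_sub_cancel_right] at h
  exact h.trans (mul_le_mul_of_nonneg_left (norm_clip_sub_clip_le hB f g x x') L.coe_nonneg)

theorem loss_le_of_mem_closedBall (hB : 0 < B) (hℓ0 : ℓ 0 = 0)
    (hL : LipschitzOnWith L ℓ (Metric.closedBall 0 (2 * B))) {z : State n}
    (hz : z ∈ Metric.closedBall (0 : State n) (2 * B)) : ℓ z ≤ 2 * L * B := by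
  have h := hL.dist_le_mul _ hz 0 (Metric.mem_closedBall_self (by linarith))
  rw [Real.dist_eq, dist_zero_right, hℓ0, sub_zero] at h
  have h2 := mul_le_mul_of_nonneg_left (mem_closedBall_zero_iff.mp hz) L.coe_nonneg
  have := (le_abs_self _).trans (h.trans h2)
  linarith

theorem trajLoss_clip_mem_Icc (hB : 0 < B) (hT : 1 ≤ T) (hℓ : ∀ z, 0 ≤ ℓ z) (hℓ0 : ℓ 0 = 0)
    (hL : LipschitzOnWith L ℓ (Metric.closedBall 0 (2 * B))) (f : State n → State n)
    {ξ : State n} (hξ : ξ ∈ boundedStarts fstar T B) :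
    trajLoss fstar T ℓ (clip B f) ξ ∈ Set.Icc 0 (2 * L * B) := by
  have hT0 : (0 : ℝ) < T := by exact_mod_cast hT
  refine ⟨mul_nonneg (by positivity) (Finset.sum_nonneg fun _ _ => hℓ _), ?_⟩
  have : ∑ t ∈ Finset.range T, ℓ (clip B f (traj fstar t ξ) - traj fstar (t + 1) ξ) ≤
      ∑ _t ∈ Finset.range T, 2 * L * B := Finset.sum_le_sum fun t ht =>
    loss_le_of_mem_closedBall hB hℓ0 hL
      (clip_sub_mem_closedBall hB f _ (hξ (t + 1) (Finset.mem_range.mp ht)))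
  simp only [Finset.sum_const, Finset.card_range, nsmul_eq_mul] at this
  rw [trajLoss, one_div, inv_mul_le_iff₀ hT0]
  exact this

theorem signedLoss_mem_Icc (hB : 0 < B) (hT : 1 ≤ T) (hℓ : ∀ z, 0 ≤ ℓ z) (hℓ0 : ℓ 0 = 0)
    (hL : LipschitzOnWith L ℓ (Metric.closedBall 0 (2 * B))) (s : Bool) (f : State n → State n)
    (ξ : State n) :
    0 ≤ boolSign s * signedLoss fstar T ℓ B s f ξ ∧
      boolSign s * signedLoss fstar T ℓ B s f ξ ≤ 2 * L * B := by
  by_cases hξ : ξ ∈ boundedStarts fstar T B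
  · rw [signedLoss_of_mem hξ, ← mul_assoc, ← sq, boolSign_sq, one_mul]
    exact trajLoss_clip_mem_Icc hB hT hℓ hℓ0 hL f hξ
  · have : (0 : ℝ) ≤ 2 * L * B := by positivity
    simpa [signedLoss, hξ] using this

theorem abs_signedLoss_le (hB : 0 < B) (hT : 1 ≤ T) (hℓ : ∀ z, 0 ≤ ℓ z) (hℓ0 : ℓ 0 = 0)
    (hL : LipschitzOnWith L ℓ (Metric.closedBall 0 (2 * B))) (s : Bool) (f : State n → State n)
    (ξ : State n) : |signedLoss fstar T ℓ B s f ξ| ≤ 2 * L * B := by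
  obtain ⟨h1, h2⟩ := signedLoss_mem_Icc (fstar := fstar) hB hT hℓ hℓ0 hL s f ξ
  rw [← abs_of_nonneg h1, abs_mul, abs_boolSign, one_mul] at h2
  exact h2

/-- The values lie in `[0, 2LB]` or in `[-2LB, 0]`, according to `s`, so the oscillation is `2LB`
rather than `4LB`. Three times this is the constant `6LB`. -/
theorem signedLoss_sub_le (hB : 0 < B) (hT : 1 ≤ T) (hℓ : ∀ z, 0 ≤ ℓ z) (hℓ0 : ℓ 0 = 0)
    (hL : LipschitzOnWith L ℓ (Metric.closedBall 0 (2 * B))) (s : Bool) (f : State n → State n)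
    (ξ ξ' : State n) :
    signedLoss fstar T ℓ B s f ξ - signedLoss fstar T ℓ B s f ξ' ≤ 2 * L * B := by
  have h1 := signedLoss_mem_Icc (fstar := fstar) hB hT hℓ hℓ0 hL s f ξ
  have h2 := signedLoss_mem_Icc (fstar := fstar) hB hT hℓ hℓ0 hL s f ξ'
  cases s
  · simp only [boolSign, Bool.false_eq_true, if_false] at h1 h2
    linarith [h1.1, h2.2]
  · simp only [boolSign, if_true] at h1 h2
    linarith [h1.2, h2.1]

theorem measurable_signedLoss (hfstar : Measurable fstar) (hB : 0 < B) (hℓ : Continuous ℓ)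
    (s : Bool) {f : State n → State n} (hf : Continuous f) :
    Measurable (signedLoss fstar T ℓ B s f) := by
  refine Measurable.indicator ?_ (measurableSet_boundedStarts hfstar T B)
  refine Measurable.const_mul (Measurable.const_mul (Finset.measurable_sum _ fun t _ => ?_) _) _
  exact hℓ.measurable.comp
    (((continuous_clip hB hf).measurable.comp (measurable_traj hfstar t)).sub
      (measurable_traj hfstar (t + 1)))

theorem tendsto_signedLoss (hB : 0 < B) (hℓ : Continuous ℓ) (s : Bool)
    {F : ℕ → State n → State n} {f : State n → State n}
    (h : ∀ x, Tendsto (fun k => F k x) atTop (𝓝 (f x))) (ξ : State n) :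
    Tendsto (fun k => signedLoss fstar T ℓ B s (F k) ξ) atTop
      (𝓝 (signedLoss fstar T ℓ B s f ξ)) := by
  by_cases hξ : ξ ∈ boundedStarts fstar T B
  · simp only [signedLoss_of_mem hξ, trajLoss]
    refine Tendsto.const_mul _ (Tendsto.const_mul _ (tendsto_finsetSum _ fun t _ => ?_))
    exact (hℓ.tendsto _).comp ((tendsto_clip hB (z := fun _ => traj fstar t ξ) (h _)).sub_const _)
  · simp [signedLoss, hξ]

/-- The empirical Rademacher complexity of the losses of a norm-constrained RKHS. -/
theorem empRademacher_signedLoss_le {N : ℕ} (hB : 0 < B)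
    (hL : LipschitzOnWith L ℓ (Metric.closedBall 0 (2 * B))) (s : Bool) (κ : PDSKernel (State n))
    {m : ℝ} (hm : 0 ≤ m) {ι : Type*} [Nonempty ι] [Finite ι] {f : ι → State n → State n}
    (hf : ∀ a, f a ∈ rkhsClass κ m) {ξ : Fin N → State n}
    (hξ : ∀ i, ξ i ∈ boundedStarts fstar T B) :
    empRademacher (fun a => signedLoss fstar T ℓ B s (f a)) ξ ≤
      1 / (T : ℝ) * ∑ t ∈ Finset.range T, √2 * L * n * m *
        √(∑ i, κ.ker (traj fstar t (ξ i)) (traj fstar t (ξ i))) := by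
  set h : ℕ → Fin N → ι → ℝ := fun t i a =>
    boolSign s * ℓ (clip B (f a) (traj fstar t (ξ i)) - traj fstar (t + 1) (ξ i)) with hh
  calc empRademacher (fun a => signedLoss fstar T ℓ B s (f a)) ξ
      ≤ 𝔼 σ : Fin N → Bool, 1 / (T : ℝ) * ∑ t ∈ Finset.range T,
          ⨆ a, (0 + ∑ i, boolSign (σ i) * h t i a) := by
        refine Finset.expect_le_expect fun σ _ => ciSup_le fun a => ?_
        have : ∑ i, boolSign (σ i) * signedLoss fstar T ℓ B s (f a) (ξ i) =
            1 / (T : ℝ) * ∑ t ∈ Finset.range T, (0 + ∑ i, boolSign (σ i) * h t i a) := by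
          simp only [signedLoss_of_mem (hξ _), trajLoss, zero_add, hh]
          rw [Finset.sum_comm, Finset.mul_sum]
          refine Finset.sum_congr rfl fun i _ => ?_
          simp only [← Finset.mul_sum]
          ring
        rw [this]
        exact mul_le_mul_of_nonneg_left (Finset.sum_le_sum fun t _ =>
          le_finite_iSup (fun a => 0 + ∑ i, boolSign (σ i) * h t i a) a) (by positivity)
    _ = 1 / (T : ℝ) * ∑ t ∈ Finset.range T, 𝔼 σ : Fin N → Bool,
          ⨆ a, (0 + ∑ i, boolSign (σ i) * h t i a) := by
        rw [← Finset.mul_expect, Finset.expect_sum_comm]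
    _ ≤ _ := by
        refine mul_le_mul_of_nonneg_left (Finset.sum_le_sum fun t ht => ?_) (by positivity)
        refine (expect_iSup_contraction L.coe_nonneg (fun _ => 0) (h t)
          (fun i a => f a (traj fstar t (ξ i))) fun i a b => ?_).trans ?_
        · simp only [hh]
          rw [← mul_sub, abs_mul, abs_boolSign, one_mul]
          exact abs_sub_le_of_clip hB hL _ _ _ _ (hξ i (t + 1) (Finset.mem_range.mp ht))
        · simp only [zero_add]
          exact expect_iSup_rkhsClass_le κ hm (by positivity) hf fun i => traj fstar t (ξ i)

theorem trainError_eq {N : ℕ} (ξ : Fin N → State n) (f : State n → State n) :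
    trainError fstar T ℓ ξ f = 1 / (N : ℝ) * ∑ i, trajLoss fstar T ℓ f (ξ i) := by
  simp only [trainError, trajLoss, ← Finset.mul_sum]
  rw [← mul_assoc]
  congr 1
  rw [one_div_mul_one_div]

/-- One-sided uniform deviation bound for the clipped predictors of a norm-constrained RKHS. -/
theorem exists_rkhsClass_deviation {N : ℕ} (hN : 1 ≤ N) (hT : 1 ≤ T) (hfstar : Measurable fstar)
    (D : Measure (State n)) [IsProbabilityMeasure D] (hB : 0 < B)
    (hbound : ∀ᵐ ξ ∂D, ∀ t ≤ T, ‖traj fstar t ξ‖ ≤ B)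
    (hℓ_nonneg : ∀ z, 0 ≤ ℓ z) (hℓ : Continuous ℓ) (hℓ_zero : ℓ 0 = 0)
    (hL : 0 < L) (hL_lip : LipschitzOnWith L ℓ (Metric.closedBall 0 (2 * B)))
    (s : Bool) (κ : PDSKernel (State n)) {m : ℝ} (hm : 0 ≤ m)
    {δ : ℝ} (hδ0 : 0 < δ) (hδ1 : δ ≤ 1) :
    ∃ A : Set (Fin N → State n), (Measure.pi fun _ : Fin N => D) A ≤ ENNReal.ofReal δ ∧
      ∀ ξ ∉ A, ∀ f ∈ rkhsClass κ m,
        boolSign s *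
            (trueError fstar D T ℓ (clip B f) - trainError fstar T ℓ ξ (clip B f)) ≤
          rkhsPenalty fstar T L κ ξ m + 6 * L * B * √(Real.log (1 / δ) / (2 * N)) := by
  obtain ⟨u, hu, hdense⟩ := exists_pointwise_dense_seq κ hm
  set g : (State n → State n) → State n → ℝ := fun f => signedLoss fstar T ℓ B s f with hg
  have hK : ∀ f x, |g f x| ≤ 2 * L * B := fun f x =>
    abs_signedLoss_le hB hT hℓ_nonneg hℓ_zero hL_lip s f x
  have hmeas : ∀ f ∈ rkhsClass κ m, Measurable (g f) := fun f hf =>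
    measurable_signedLoss hfstar hB hℓ s (continuous_of_mem_rkhsClass hf)
  obtain ⟨A, hA, hdev⟩ := exists_uniform_deviation D hN (g := fun k => g (u k))
    (fun k => hmeas _ (hu k)) (fun k => hK _) (C := 2 * L * B) (by positivity)
    (fun k => signedLoss_sub_le hB hT hℓ_nonneg hℓ_zero hL_lip s (u k)) hδ0 hδ1
  have hN0 : (0 : ℝ) < N := by exact_mod_cast hN
  -- Samples with an unbounded trajectory form a null set; off it the truncated losses equal the
  -- true ones.
  refine ⟨A ∪ {ξ | ¬ ∀ i, ξ i ∈ boundedStarts fstar T B}, ?_, fun ξ hξ f hf => ?_⟩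
  · refine (measure_union_le _ _).trans ?_
    have h0 : (Measure.pi fun _ : Fin N => D) {ξ | ¬ ∀ i, ξ i ∈ boundedStarts fstar T B} = 0 := by
      rw [← ae_iff, ae_all_iff]
      exact fun i => (measurePreserving_eval (fun _ : Fin N => D) i).quasiMeasurePreserving.ae
        hbound
    rw [h0, add_zero]
    exact hA
  · rw [Set.mem_union, not_or] at hξ
    obtain ⟨hξA, hξG⟩ := hξ
    replace hξG : ∀ i, ξ i ∈ boundedStarts fstar T B := not_not.mp hξG
    set R := 1 / (T : ℝ) * ∑ t ∈ Finset.range T, √2 * L * n * m *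
        √(∑ i, κ.ker (traj fstar t (ξ i)) (traj fstar t (ξ i))) with hR
    set S := 2 * R + 3 * (2 * L * B) * √(N * Real.log (1 / δ) / 2) with hS
    have hseq := hdev ξ hξA R fun M =>
      empRademacher_signedLoss_le hB hL_lip s κ hm (fun a : Fin (M + 1) => hu a) hξG
    obtain ⟨φ, hφ⟩ := hdense f hf
    -- The bound for the dense sequence passes to `f` by dominated convergence for the means and
    -- pointwise convergence at the sample.
    have hlim : Tendsto (fun k => ∑ i, (∫ x, g (u (φ k)) x ∂D - g (u (φ k)) (ξ i))) atTop
        (𝓝 (∑ i, (∫ x, g f x ∂D - g f (ξ i)))) := by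
      refine tendsto_finsetSum _ fun i _ => Tendsto.sub ?_ (tendsto_signedLoss hB hℓ s hφ _)
      exact tendsto_integral_of_dominated_convergence (fun _ => 2 * L * B)
        (fun k => (hmeas _ (hu _)).aestronglyMeasurable) (integrable_const _)
        (fun k => ae_of_all _ (hK _)) (ae_of_all _ fun x => tendsto_signedLoss hB hℓ s hφ x)
    have hle : ∑ i, (∫ x, g f x ∂D - g f (ξ i)) ≤ S := le_of_tendsto' hlim fun k => hseq (φ k)
    have hint : ∫ x, g f x ∂D = boolSign s * trueError fstar D T ℓ (clip B f) := by
      rw [trueError, ← integral_const_mul]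
      refine integral_congr_ae ?_
      filter_upwards [hbound] with x hx
      exact signedLoss_of_mem hx s f
    have hsum : ∑ i, (∫ x, g f x ∂D - g f (ξ i)) = N * (boolSign s *
        (trueError fstar D T ℓ (clip B f) - trainError fstar T ℓ ξ (clip B f))) := by
      rw [Finset.sum_sub_distrib, hint, trainError_eq]
      simp only [hg, signedLoss_of_mem (hξG _), ← Finset.mul_sum, Finset.sum_const,
        Finset.card_univ, Fintype.card_fin, nsmul_eq_mul]
      field_simp
    have hsqrt : √(N * Real.log (1 / δ) / 2) = N * √(Real.log (1 / δ) / (2 * N)) := by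
      rw [← Real.sqrt_sq hN0.le, ← Real.sqrt_mul (sq_nonneg _), Real.sqrt_sq hN0.le]
      congr 1
      field_simp
    have hpen : 2 * R = N * rkhsPenalty fstar T L κ ξ m := by
      rw [hR, rkhsPenalty, ← Finset.mul_sum]
      field_simp
    rw [hsum, hS, hpen, hsqrt] at hle
    refine le_of_mul_le_mul_left (hle.trans_eq ?_) hN0
    ring

end

/-! ### Union bounds and structural risk minimization. -/

/-- The exceptional set need not be measurable; the complement of its measurable hull serves as the
event. -/
theorem holdsWithProb_of_not_mem {Ω : Type} [MeasurableSpace Ω] {μ : Measure Ω}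
    [IsProbabilityMeasure μ] {p : ℝ} (hp : 0 ≤ p) {P : Ω → Prop} {A : Set Ω}
    (hA : μ A ≤ ENNReal.ofReal p) (h : ∀ ω ∉ A, P ω) : HoldsWithProb μ (1 - p) P := by
  refine ⟨(toMeasurable μ A)ᶜ, (measurableSet_toMeasurable _ _).compl, ?_, fun ω hω =>
    h ω fun hA => hω (subset_toMeasurable _ _ hA)⟩
  rw [prob_compl_eq_one_sub (measurableSet_toMeasurable _ _), measure_toMeasurable,
    ENNReal.ofReal_sub _ hp, ENNReal.ofReal_one]
  exact tsub_le_tsub_left hA _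

theorem rkhsPenalty_mono {n N : ℕ} (fstar : State n → State n) (T : ℕ) (L : ℝ≥0)
    (κ : PDSKernel (State n)) (ξ : Fin N → State n) {m m' : ℝ} (h : m ≤ m') :
    rkhsPenalty fstar T L κ ξ m ≤ rkhsPenalty fstar T L κ ξ m' := by
  refine mul_le_mul_of_nonneg_right ?_ (Finset.sum_nonneg fun _ _ => Real.sqrt_nonneg _)
  gcongr

/-- The top level admits `f`, so the infimum is over a nonempty set and is attained, instead of
taking the default value 0. -/
theorem normLevel_mem {n : ℕ} {κ : PDSKernel (State n)} {Q : ℕ} (hQ : 1 ≤ Q) {M : ℕ → ℝ}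
    {f : State n → State n} {b : ℝ} (hf : f ∈ rkhsClass κ b) (hb : b ≤ M Q) :
    normLevel κ Q M f ∈ Set.Icc 1 Q ∧ f ∈ rkhsClass κ (M (normLevel κ Q M f)) :=
  Nat.sInf_mem (s := {q | q ∈ Set.Icc 1 Q ∧ f ∈ rkhsClass κ (M q)})
    ⟨Q, ⟨hQ, le_rfl⟩, rkhsClass_mono κ hb hf⟩

theorem measure_biUnion_Icc_le {Ω : Type*} [MeasurableSpace Ω] (μ : Measure Ω) {A : ℕ → Set Ω}
    {Q : ℕ} {p : ℝ} (h : ∀ q ∈ Set.Icc 1 Q, μ (A q) ≤ ENNReal.ofReal p) :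
    μ (⋃ q ∈ Finset.Icc 1 Q, A q) ≤ ENNReal.ofReal (Q * p) := by
  refine (measure_biUnion_finset_le _ _).trans ?_
  refine (Finset.sum_le_sum fun q hq => h q (Finset.mem_Icc.mp hq)).trans_eq ?_
  rw [Finset.sum_const, Nat.card_Icc, add_tsub_cancel_right, nsmul_eq_mul,
    ENNReal.ofReal_mul (Nat.cast_nonneg _), ENNReal.ofReal_natCast]

/-- Two-sided deviation bound, simultaneously for all the norm levels `M 1, …, M Q`; the exceptional
set has probability at most `η / 2`. -/
theorem exists_normLevel_deviation {n N T Q : ℕ} (hN : 1 ≤ N) (hT : 1 ≤ T) (hQ : 1 ≤ Q)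
    {fstar : State n → State n} (hfstar : Measurable fstar)
    (D : Measure (State n)) [IsProbabilityMeasure D] {B : ℝ} (hB : 0 < B)
    (hbound : ∀ᵐ ξ ∂D, ∀ t ≤ T, ‖traj fstar t ξ‖ ≤ B)
    {ℓ : State n → ℝ} (hℓ_nonneg : ∀ z, 0 ≤ ℓ z) (hℓ : Continuous ℓ) (hℓ_zero : ℓ 0 = 0)
    {L : ℝ≥0} (hL : 0 < L) (hL_lip : LipschitzOnWith L ℓ (Metric.closedBall 0 (2 * B)))
    (κ : PDSKernel (State n)) {M : ℕ → ℝ} (hM : ∀ q ∈ Set.Icc 1 Q, 0 < M q)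
    {η : ℝ} (hη0 : 0 < η) (hη1 : η ≤ 1) :
    ∃ A : Set (Fin N → State n), (Measure.pi fun _ : Fin N => D) A ≤ ENNReal.ofReal (η / 2) ∧
      ∀ ξ ∉ A, ∀ q ∈ Set.Icc 1 Q, ∀ f ∈ rkhsClass κ (M q),
        |trueError fstar D T ℓ (clip B f) - trainError fstar T ℓ ξ (clip B f)| ≤
          rkhsPenalty fstar T L κ ξ (M q) + 6 * L * B * √(Real.log (4 * Q / η) / (2 * N)) := by
  have hQ0 : (1 : ℝ) ≤ Q := by exact_mod_cast hQ
  -- There are `2Q` events, one for each sign and level, so `η / (4Q)` each gives `η / 2` in total.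
  have hδ0 : 0 < η / (4 * Q) := by positivity
  have hδ1 : η / (4 * Q) ≤ 1 := by rw [div_le_one (by positivity)]; linarith
  have hone : ∀ (s : Bool) (q : ℕ), ∃ A : Set (Fin N → State n), q ∈ Set.Icc 1 Q →
      (Measure.pi fun _ : Fin N => D) A ≤ ENNReal.ofReal (η / (4 * Q)) ∧
      ∀ ξ ∉ A, ∀ f ∈ rkhsClass κ (M q),
        boolSign s *
            (trueError fstar D T ℓ (clip B f) - trainError fstar T ℓ ξ (clip B f)) ≤
          rkhsPenalty fstar T L κ ξ (M q) +
            6 * L * B * √(Real.log (1 / (η / (4 * Q))) / (2 * N)) := fun s q => by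
    by_cases hq : q ∈ Set.Icc 1 Q
    · obtain ⟨A, hA⟩ := exists_rkhsClass_deviation hN hT hfstar D hB hbound hℓ_nonneg hℓ hℓ_zero
        hL hL_lip s κ (hM q hq).le hδ0 hδ1
      exact ⟨A, fun _ => hA⟩
    · exact ⟨∅, fun h => absurd h hq⟩
  choose A hA using hone
  refine ⟨⋃ s, ⋃ q ∈ Finset.Icc 1 Q, A s q, ?_, fun ξ hξ q hq f hf => ?_⟩
  · refine (measure_iUnion_fintype_le _ _).trans ?_
    rw [Fintype.sum_bool]
    refine (add_le_add (measure_biUnion_Icc_le _ fun q hq => (hA true q hq).1)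
      (measure_biUnion_Icc_le _ fun q hq => (hA false q hq).1)).trans_eq ?_
    rw [← ENNReal.ofReal_add (by positivity) (by positivity)]
    congr 1
    field_simp
    norm_num
  · have hnot : ∀ s, ξ ∉ A s q := fun s h =>
      hξ (Set.mem_iUnion.mpr ⟨s, Set.mem_biUnion (Finset.mem_Icc.mpr hq) h⟩)
    have h1 := (hA true q hq).2 ξ (hnot true) f hf
    have h2 := (hA false q hq).2 ξ (hnot false) f hf
    rw [one_div_div] at h1 h2
    simp only [boolSign, Bool.false_eq_true, if_false, if_true] at h1 h2
    exact abs_le.mpr ⟨by linarith, by linarith⟩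

end

theorem theorem3
    {n N T K Q : ℕ} (hN : 1 ≤ N) (hT : 1 ≤ T) (hK : 1 ≤ K) (hQ : 1 ≤ Q)
    -- the system, the distribution of the initial state, the state bound
    (fstar : State n → State n) (hfstar : Measurable fstar)
    (D : Measure (State n)) [IsProbabilityMeasure D]
    (B : ℝ) (hB : 0 < B)
    (hbound : ∀ᵐ ξ ∂D, ∀ t ≤ T, ‖traj fstar t ξ‖ ≤ B)
    -- the loss and its Lipschitz constant on the ball of radius `2B`
    (ℓ : State n → ℝ) (hℓ_nonneg : ∀ z, 0 ≤ ℓ z) (hℓ_lip : LocallyLipschitz ℓ) (hℓ_zero : ℓ 0 = 0)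
    (L : ℝ≥0) (hL : 0 < L) (hL_lip : LipschitzOnWith L ℓ (Metric.closedBall 0 (2 * B)))
    -- the hierarchy of norm-constrained RKHS classes
    (κ : ℕ → PDSKernel (State n)) (b : ℕ → ℝ) (hb : ∀ k ∈ Set.Icc 1 K, 0 < b k)
    (F : ℕ → Set (State n → State n)) (hF : ∀ k ∈ Set.Icc 1 K, F k = rkhsClass (κ k) (b k))
    (hnested : ∀ k, 1 ≤ k → k + 1 ≤ K → F k ⊆ F (k + 1))
    -- the norm levels `M 1 ≤ … ≤ M Q = max_k b k`
    (M : ℕ → ℝ) (hM_pos : ∀ q ∈ Set.Icc 1 Q, 0 < M q) (hM_mono : MonotoneOn M (Set.Icc 1 Q))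
    (hM_last : IsGreatest (b '' Set.Icc 1 K) (M Q))
    -- the class predictors `f_k` (functions of the sample)
    (fhat : (Fin N → State n) → ℕ → State n → State n)
    (hfhat : ∀ ξ, ∀ k ∈ Set.Icc 1 K, IsClassPredictor fstar T ℓ B ξ (F k) (fhat ξ k))
    -- the penalties `r_k(S)`
    (r : (Fin N → State n) → ℕ → ℝ)
    (hr : ∀ ξ k, r ξ k =
      rkhsPenalty fstar T L (κ k) ξ (M (normLevel (κ k) Q M (fhat ξ k))))
    -- the quantity `r̃_k(S)`, which also depends on the competing `f`
    (rtilde : (Fin N → State n) → ℕ → (State n → State n) → ℝ)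
    (hrtilde : ∀ ξ k f, rtilde ξ k f = rkhsPenalty fstar T L (κ k) ξ
      (M (max (normLevel (κ k) Q M (fhat ξ k)) (normLevel (κ k) Q M f))))
    -- the bound `ε_k(S, δ)`
    (ε : (Fin N → State n) → ℕ → (State n → State n) → ℝ → ℝ)
    (hε : ∀ ξ k f η, ε ξ k f η =
      rtilde ξ k f + 6 * L * B * √(Real.log (4 * Q / η) / (2 * N)))
    -- the SRM predictor (a function of the sample)
    (fSRM : (Fin N → State n) → State n → State n)
    (hfSRM : ∀ ξ, IsSRMPredictor fstar T ℓ B ξ K F (r ξ) (fhat ξ) (fSRM ξ))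
    (δ : ℝ) (hδ_pos : 0 < δ) (hδ_lt : δ < 1) :
    (∀ k ∈ Set.Icc 1 K,
      HoldsWithProb (Measure.pi fun _ : Fin N => D) (1 - δ) fun ξ =>
        ∀ f ∈ F k,
          |trueError fstar D T ℓ (clip B f) - trainError fstar T ℓ ξ (clip B f)| ≤ ε ξ k f δ) ∧
    HoldsWithProb (Measure.pi fun _ : Fin N => D) (1 - δ) fun ξ =>
      ∀ f ∈ ⋃ k ∈ Set.Icc 1 K, F k,
        trueError fstar D T ℓ (clip B (fSRM ξ)) ≤
          trueError fstar D T ℓ (clip B f) +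
            2 * ε ξ (classIndex K F f) f (2 * δ / (K + 1)) := by
  have hℓ : Continuous ℓ := hℓ_lip.continuous
  have hbM : ∀ k ∈ Set.Icc 1 K, b k ≤ M Q := fun k hk => hM_last.2 ⟨k, hk, rfl⟩
  have hlevel : ∀ k ∈ Set.Icc 1 K, ∀ f ∈ F k, normLevel (κ k) Q M f ∈ Set.Icc 1 Q ∧
      f ∈ rkhsClass (κ k) (M (normLevel (κ k) Q M f)) := fun k hk f hf =>
    normLevel_mem hQ (hF k hk ▸ hf) (hbM k hk)
  have hmax : ∀ ξ, ∀ k ∈ Set.Icc 1 K, ∀ f ∈ F k,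
      rkhsPenalty fstar T L (κ k) ξ (M (normLevel (κ k) Q M f)) ≤ rtilde ξ k f ∧
        r ξ k ≤ rtilde ξ k f := fun ξ k hk f hf => by
    have h1 := (hlevel k hk f hf).1
    have h2 := (hlevel k hk _ (hfhat ξ k hk).1).1
    have h3 : max (normLevel (κ k) Q M (fhat ξ k)) (normLevel (κ k) Q M f) ∈ Set.Icc 1 Q :=
      ⟨le_max_of_le_left h2.1, max_le h2.2 h1.2⟩
    rw [hrtilde, hr]
    exact ⟨rkhsPenalty_mono _ _ _ _ _ (hM_mono h1 h3 (le_max_right _ _)),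
      rkhsPenalty_mono _ _ _ _ _ (hM_mono h2 h3 (le_max_left _ _))⟩
  refine ⟨fun k hk => ?_, ?_⟩
  · obtain ⟨A, hA, hdev⟩ := exists_normLevel_deviation hN hT hQ hfstar D hB hbound hℓ_nonneg hℓ
      hℓ_zero hL hL_lip (κ k) hM_pos hδ_pos hδ_lt.le
    refine holdsWithProb_of_not_mem hδ_pos.le
      (hA.trans (ENNReal.ofReal_le_ofReal (by linarith))) fun ξ hξ f hf => ?_
    obtain ⟨h1, h2⟩ := hlevel k hk f hf
    have h3 := hdev ξ hξ _ h1 f h2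
    rw [hε]
    linarith [(hmax ξ k hk f hf).1]
  · have hK1 : (1 : ℝ) ≤ K := by exact_mod_cast hK
    -- Each class costs `η / 2 = δ / (K + 1)`, so all `K` classes together cost less than `δ`. The
    -- form of `η` also ensures `η ≤ 1`.
    set η : ℝ := 2 * δ / (K + 1) with hη
    have hη0 : 0 < η := by positivity
    have hη1 : η ≤ 1 := by rw [hη, div_le_one (by positivity)]; linarith
    choose A hA hdev using fun k => exists_normLevel_deviation hN hT hQ hfstar D hB hbound
      hℓ_nonneg hℓ hℓ_zero hL hL_lip (κ k) hM_pos hη0 hη1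
    refine holdsWithProb_of_not_mem (A := ⋃ k ∈ Finset.Icc 1 K, A k) hδ_pos.le
      ((measure_biUnion_Icc_le _ fun k _ => hA k).trans (ENNReal.ofReal_le_ofReal ?_))
      fun ξ hξ f hf => ?_
    · rw [hη]
      have : (K : ℝ) * (2 * δ / (K + 1) / 2) = δ * (K / (K + 1)) := by field_simp
      rw [this]
      exact mul_le_of_le_one_right hδ_pos.le ((div_le_one (by positivity)).mpr (by linarith))
    · have hgood : ∀ k ∈ Set.Icc 1 K, ∀ f ∈ F k,
          |trueError fstar D T ℓ (clip B f) - trainError fstar T ℓ ξ (clip B f)| ≤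
            rkhsPenalty fstar T L (κ k) ξ (M (normLevel (κ k) Q M f)) +
              6 * L * B * √(Real.log (4 * Q / η) / (2 * N)) := fun k hk f hf => by
        obtain ⟨h1, h2⟩ := hlevel k hk f hf
        exact hdev k ξ (fun h => hξ (Set.mem_biUnion (Finset.mem_Icc.mpr hk) h)) _ h1 f h2
      obtain ⟨hj, hfj⟩ : classIndex K F f ∈ Set.Icc 1 K ∧ f ∈ F (classIndex K F f) := by
        obtain ⟨k, hk, hfk⟩ := Set.mem_iUnion₂.mp hf
        exact Nat.sInf_mem (s := {k | k ∈ Set.Icc 1 K ∧ f ∈ F k}) ⟨k, hk, hfk⟩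
      set j := classIndex K F f
      obtain ⟨k, hk, hfk, hmin⟩ := hfSRM ξ
      have h1 := abs_le.mp (hgood k hk _ (hfhat ξ k hk).1)
      have h2 := abs_le.mp (hgood j hj f hfj)
      have h3 := hmin j hj f hfj
      -- The penalty of the chosen class is exactly the deviation bound at the norm level of its
      -- predictor, so it cancels against `h1`. What remains is the deviation of `f`, the penalty
      -- `r_j` and two confidence terms.
      rw [hr ξ k, hfk] at h3
      rw [hfk, hε]
      have h4 := hmax ξ j hj f hfj
      linarith [h1.2, h2.1, h4.1, h4.2]
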